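/- Conventions. A parameterized problem is a language $Q\subseteq\Sigma^*\times\mathbb{N}$ for a finite alphabet $\Sigma$; the number $k$ in $(x,k)$ is the parameter. A polynomial parameter transformation (PPT) from $Q\subseteq\Sigma^*\times\mathbb{N}$ to $Q'\subseteq\Gamma^*\times\mathbb{N}$ is a map $\pi\colon\Sigma^*\times\mathbb{N}\to\Gamma^*\times\mathbb{N}$, computable in time polynomial in $|x|+k$, such that for all $(x,k)$ and $(x',k')=\pi(x,k)$ we have $(x,k)\in Q\iff(x',k')\in Q'$, and $k'\le p(k)$ for a fixed polynomial $p$. The problem Hitting Set$[n]$ has as input a finite ground set $U$, a family $\mathcal{F}$ of subsets of $U$ and $k\in\mathbb{N}$; its parameter is $n=|U|$; the question is whether some $S\subseteq U$ with $|S|\le k$ meets every $F\in\mathcal{F}$. The class $\mathsf{MK[2]}$ consists of all parameterized problems that have a PPT to Hitting Set$[n]$. A problem is $\mathsf{MK[2]}$-hard under PPTs if every problem in $\mathsf{MK[2]}$ has a PPT to it. A stable cutset of a finite simple graph $G$ is a set $S\subseteq V(G)$ of pairwise non-adjacent vertices such that $G-S$ is disconnected. The problem Stable Cutset[mod path] has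 as input a finite simple graph $G$ and a set $X\subseteq V(G)$ such that $G-X$ is a single path; its parameter is $|X|$; the question is whether $G$ has a stable cutset. Corollary. Stable Cutset[mod path] is $\mathsf{MK[2]}$-hard under PPTs. -/

import Mathlib

namespace ParamComplexity

/-- A parameterized problem over the alphabet `α`: a language `L ⊆ α* × ℕ`. -/
abbrev ParamProblem (α : Type) : Type := Set (List α × ℕ)

/-- How an instance `(x, k)` of a parameterized problem is written on the tape of a machine:
`k` copies of a separator symbol `none`, followed by the word `x`. This word has length `|x| + k`,
so that "polynomial time" means time polynomial in `|x| + k`. -/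
def encodeInstance {α : Type} (p : List α × ℕ) : List (Option α) :=
  List.replicate p.2 none ++ p.1.map some

/-- `π` is a polynomial parameter transformation (PPT) from `Q` to `Q'`: it is computable in
polynomial time by a Turing machine, it preserves membership and non-membership, and the new
parameter is bounded by a polynomial in the old parameter. -/
structure IsPPT {α β : Type} (Q : ParamProblem α) (Q' : ParamProblem β)
    (π : List α × ℕ → List β × ℕ) : Prop where
  polyTime : Nonempty (Turing.TM2ComputableInPolyTime
    (encodeInstance (α := α)) (encodeInstance (α := β)) π)
  mem_iff : ∀ p, p ∈ Q ↔ π p ∈ Q'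
  param_le : ∃ b : Polynomial ℕ, ∀ p, (π p).2 ≤ b.eval p.2

/-- There is a PPT from `Q` to `Q'`. -/
def PPTReducible {α β : Type} (Q : ParamProblem α) (Q' : ParamProblem β) : Prop :=
  ∃ π, IsPPT Q Q' π

/-- A finite sequence of binary words is written as one word over the alphabet `{0, 1, #}`
(where `#` is `none`): each word is terminated by `#`. -/
def encodeWords (ws : List (List Bool)) : List (Option Bool) :=
  ws.flatMap fun w => w.map some ++ [none]

/-- A natural number in unary. -/
def unary (n : ℕ) : List Bool := List.replicate n true

/-- The characteristic vector of a subset of `{0, …, n - 1}`. -/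
def charVector {n : ℕ} (s : Finset (Fin n)) : List Bool :=
  List.ofFn fun i => decide (i ∈ s)

/-- An input of Hitting Set: a finite ground set `U = {0, …, n - 1}`, a family of subsets of `U`,
and a number `k`. -/
structure HittingSetInput where
  n : ℕ
  family : Finset (Finset (Fin n))
  k : ℕ

namespace HittingSetInput

/-- Is there a hitting set of size at most `k`? -/
def Yes (I : HittingSetInput) : Prop :=
  ∃ S : Finset (Fin I.n), S.card ≤ I.k ∧ ∀ F ∈ I.family, (S ∩ F).Nonempty

/-- The word `x` describes the input `I`: it lists `n`, `k`, and, in some order, the characteristic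
vectors of the members of the family. -/
def EncodedBy (I : HittingSetInput) (x : List (Option Bool)) : Prop :=
  ∃ L : List (Finset (Fin I.n)), L.toFinset = I.family ∧
    x = encodeWords (unary I.n :: unary I.k :: L.map charVector)

end HittingSetInput

/-- The parameterized problem Hitting Set[n]: Hitting Set, parameterized by the size `n` of the
ground set. -/
def hittingSet : ParamProblem (Option Bool) :=
  {p | ∃ I : HittingSetInput, I.EncodedBy p.1 ∧ p.2 = I.n ∧ I.Yes}

/-- The class MK[2]: all parameterized problems that have a PPT to Hitting Set[n]. -/
def InMK2 {α : Type} (Q : ParamProblem α) : Prop := PPTReducible Q hittingSet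

/-- `Q'` is MK[2]-hard under PPTs: every problem in MK[2], over any finite alphabet, has a PPT
to `Q'`. -/
def IsMK2Hard {β : Type} (Q' : ParamProblem β) : Prop :=
  ∀ (α : Type) [Fintype α] (Q : ParamProblem α), InMK2 Q → PPTReducible Q Q'

/-- `S` is a stable cutset of `G`: `S` is a stable (independent) set and `G - S` is disconnected,
that is, two vertices of `G - S` are not joined by a path in `G - S`
(a graph without vertices is not disconnected). -/
def IsStableCutset {V : Type} (G : SimpleGraph V) (S : Set V) : Prop :=
  G.IsIndepSet S ∧ ¬ (G.induce Sᶜ).Preconnected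

/-- `G` is a single path, with at least one vertex. -/
def IsSinglePath {V : Type} (G : SimpleGraph V) : Prop :=
  ∃ m : ℕ, Nonempty (G ≃g SimpleGraph.pathGraph (m + 1))

/-- A finite simple graph `G` on the vertex set `{0, …, N - 1}` with a vertex set `X`. -/
structure GraphWithSet where
  N : ℕ
  G : SimpleGraph (Fin N)
  X : Finset (Fin N)

namespace GraphWithSet

/-- The word `x` describes `(G, X)`: it lists the characteristic vector of `X` (whose length is the
number of vertices) and, in some order, the two endpoints of every edge of `G`. -/
def EncodedBy (I : GraphWithSet) (x : List (Option Bool)) : Prop :=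
  ∃ E : List (Fin I.N × Fin I.N), (∀ u v, I.G.Adj u v ↔ (u, v) ∈ E ∨ (v, u) ∈ E) ∧
    x = encodeWords (charVector I.X :: E.flatMap fun e => [unary e.1, unary e.2])

end GraphWithSet

/-- The parameterized problem Stable Cutset[mod path]: given a graph `G` and a vertex set `X` such
that `G - X` is a single path, does `G` have a stable cutset? The parameter is `|X|`. -/
def stableCutsetModPath : ParamProblem (Option Bool) :=
  {p | ∃ I : GraphWithSet, I.EncodedBy p.1 ∧ IsSinglePath (I.G.induce ((I.X : Set (Fin I.N))ᶜ)) ∧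
    p.2 = I.X.card ∧ ∃ S : Set (Fin I.N), IsStableCutset I.G S}

end ParamComplexity

/-! Every problem in MK[2] has a PPT to Hitting Set[n], so it suffices to follow such a PPT by one
reduction from Hitting Set[n] to Stable Cutset[mod path].

A stable cutset is the same as a labelling of the vertices by `none` (the cutset) and two sides,
both used, in which no edge joins two `none` or two different sides (`exists_stableCutset_iff`). Two
adjacent vertices cannot both lie in the cutset, so an adjacent pair has a well-defined side, and
every common neighbour of the pair is in the cutset or on that side (`exists_side`).

The bound `k` may be replaced by `min n k`. The graph has two terminal pairs, with sides `c` and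
`d`, and a pair for each of the `n * k` variables "row `j` selects element `u`", which is true if
its side is `c`. Each variable also has two adjacent vertices joined to its pair, one of them joined
to the first terminal pair and the other to the second. They cannot both be in the cutset, so `c =
d` would force every variable to that side, and then no vertex could have the other side; hence `c ≠
d`. The second of these vertices is in the cutset if the variable is true; joining these vertices
within a row allows at most one true variable per row, so at most `k` elements are selected.

The path encodes the sets of the family. A separator sees both terminal pairs and is therefore in
the cutset. Between two separators, each variable whose element lies in the set contributes a vertex
that sees the first terminal pair, followed by a literal vertex that sees the pair of the variable.
If all these variables are false, membership in the cutset propagates from literal to literal up to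
the next separator, where two cutset vertices would be adjacent (`false_of_clause`). One true
literal breaks the propagation (`isChain_clause`). Thus stable cutsets exist exactly if hitting sets
do (`exists_hittingSet`, `exists_labelling`), and deleting the `4 * n * min n k + 4` vertices off
the path leaves a path.

For polynomial time, the reduction is written as a structured stack program with explicit time
bounds (`reduction_spec`), compiled to a machine (`Run.stepsTo`), and appended to the machine of the
given PPT (`polyTime_comp`). -/

namespace StackProgram

open Turing

/-! ### Machines that run for an exact number of steps -/

section Steps

variable {K : Type} [DecidableEq K] {Γ : K → Type} {Λ σ : Type}

/-- The machine `m` goes from `c` to `c'` in exactly `n` steps. -/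
def StepsTo (m : Λ → TM2.Stmt Γ Λ σ) (n : ℕ) (c c' : TM2.Cfg Γ Λ σ) : Prop :=
  (flip bind (TM2.step m))^[n] (some c) = some c'

variable {m : Λ → TM2.Stmt Γ Λ σ}

theorem StepsTo.refl (c : TM2.Cfg Γ Λ σ) : StepsTo m 0 c c := rfl

theorem StepsTo.trans {a b : ℕ} {c c' c'' : TM2.Cfg Γ Λ σ} (h : StepsTo m a c c')
    (h' : StepsTo m b c' c'') : StepsTo m (a + b) c c'' := by
  unfold StepsTo at *
  rw [add_comm, Function.iterate_add_apply, h, h']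

theorem StepsTo.single {l : Λ} {v : σ} {S : ∀ k, List (Γ k)} {c : TM2.Cfg Γ Λ σ}
    (h : TM2.stepAux (m l) v S = c) : StepsTo m 1 ⟨some l, v, S⟩ c := by
  simp [StepsTo, flip, h]

theorem iterate_step_none (n : ℕ) :
    (flip bind (TM2.step m))^[n] (none : Option (TM2.Cfg Γ Λ σ)) = none := by
  induction n with
  | zero => rfl
  | succ n ih => rw [Function.iterate_succ_apply]; exact ih

theorem StepsTo.cases_succ {n : ℕ} {c c' : TM2.Cfg Γ Λ σ} (h : StepsTo m (n + 1) c c') :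
    ∃ l, c.l = some l ∧ StepsTo m n (TM2.stepAux (m l) c.var c.stk) c' := by
  obtain ⟨l, v, S⟩ := c
  unfold StepsTo at h
  rw [Function.iterate_succ_apply] at h
  cases l with
  | none =>
    have : flip bind (TM2.step m) (some (⟨none, v, S⟩ : TM2.Cfg Γ Λ σ)) = none := rfl
    rw [this, iterate_step_none] at h
    cases h
  | some l => exact ⟨l, rfl, h⟩

/-- The largest number of symbols which a statement can push. -/
def numPush : TM2.Stmt Γ Λ σ → ℕ
  | .push _ _ q => numPush q + 1
  | .peek _ _ q => numPush q
  | .pop _ _ q => numPush q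
  | .load _ q => numPush q
  | .branch _ q r => max (numPush q) (numPush r)
  | .goto _ => 0
  | .halt => 0

theorem length_stepAux_le (q : TM2.Stmt Γ Λ σ) (v : σ) (S : ∀ k, List (Γ k)) (k : K) :
    ((TM2.stepAux q v S).stk k).length ≤ (S k).length + numPush q := by
  induction q generalizing v S with
  | push k' f q ih =>
    refine (ih _ _).trans ?_
    by_cases h : k = k'
    · subst h; simp [numPush]; omega
    · simp [numPush, Function.update_of_ne h]
  | peek k' f q ih => exact ih _ _
  | pop k' f q ih =>
    refine (ih _ _).trans ?_
    by_cases h : k = k'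
    · subst h; simp [numPush]
    · simp [numPush, Function.update_of_ne h]
  | load f q ih => exact ih _ _
  | branch f q r ihq ihr =>
    simp only [TM2.stepAux, numPush]
    cases f v
    · exact (ihr _ _).trans (by simp)
    · exact (ihq _ _).trans (by simp)
  | goto f => simp [numPush]
  | halt => simp [numPush]

/-- Bounds the length of the output of a machine by its running time, as is needed to bound the time
of a program run on that output. -/
theorem StepsTo.length_le {C : ℕ} (hC : ∀ l, numPush (m l) ≤ C) (k : K) {n : ℕ}
    {c c' : TM2.Cfg Γ Λ σ} (h : StepsTo m n c c') :
    (c'.stk k).length ≤ (c.stk k).length + C * n := by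
  induction n generalizing c with
  | zero =>
    have : c = c' := Option.some.inj h
    simp [this]
  | succ n ih =>
    obtain ⟨l, -, h⟩ := h.cases_succ
    have h1 := ih h
    have h2 := length_stepAux_le (m l) c.var c.stk k
    have h3 := hC l
    rw [mul_add]
    omega

end Steps

/-! ### Programs on stacks -/

/-- Structured programs that work on stacks indexed by `W` with symbols from `G`. -/
inductive Cmd (W G : Type) where
  /-- Do nothing. -/
  | skip : Cmd W G
  /-- Push the symbol `g` on the stack `w`. -/
  | push (w : W) (g : G) : Cmd W G
  /-- Sequential composition. -/
  | seq (c d : Cmd W G) : Cmd W G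
  /-- Pop the top of the stack `w`, if there is one, and continue according to it. -/
  | case (w : W) (f : Option G → Cmd W G) : Cmd W G
  /-- While the stack `w` has a top that satisfies `p`, pop it and run `f` on it. -/
  | whl (w : W) (p : G → Bool) (f : G → Cmd W G) : Cmd W G

scoped infixr:65 " ;; " => Cmd.seq

variable {W G : Type} [DecidableEq W]

open Function in
/-- `Run c S S' t`: started on the stacks `S`, the program `c` ends with the stacks `S'` after
`t` steps. -/
inductive Run : Cmd W G → (W → List G) → (W → List G) → ℕ → Prop
  | skip (S) : Run .skip S S 0
  | push (w g S) : Run (.push w g) S (update S w (g :: S w)) 1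
  | seq {c d S S' S'' t t'} : Run c S S' t → Run d S' S'' t' → Run (.seq c d) S S'' (t + t')
  | case {w f S S' t} : Run (f (S w).head?) (update S w (S w).tail) S' t →
      Run (.case w f) S S' (1 + t)
  | whl_done {w p f S} : (S w).head?.any p = false → Run (.whl w p f) S S 1
  | whl_step {w p f S S' S'' g r t t'} : S w = g :: r → p g = true →
      Run (f g) (update S w r) S' t → Run (.whl w p f) S' S'' t' →
      Run (.whl w p f) S S'' (1 + t + t')

namespace Cmd

/-- The labels of the compiled program. -/
@[reducible] def Lab : Cmd W G → Type
  | skip => Empty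
  | push _ _ => Unit
  | seq c d => Lab c ⊕ Lab d
  | case _ f => Option (Σ o, Lab (f o))
  | whl _ _ f => Option (Σ g, Lab (f g))

@[reducible] noncomputable def fintypeLab [Fintype G] : (c : Cmd W G) → Fintype (Lab c)
  | skip => inferInstanceAs (Fintype Empty)
  | push _ _ => inferInstanceAs (Fintype Unit)
  | seq c d =>
    letI := fintypeLab c
    letI := fintypeLab d
    inferInstanceAs (Fintype (Lab c ⊕ Lab d))
  | case _ f =>
    letI := fun o => fintypeLab (f o)
    inferInstanceAs (Fintype (Option (Σ o, Lab (f o))))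
  | whl _ _ f =>
    letI := fun g => fintypeLab (f g)
    inferInstanceAs (Fintype (Option (Σ g, Lab (f g))))

/-- The label at which the compiled program starts. -/
def entry {Λ : Type} : (c : Cmd W G) → (Lab c → Λ) → Λ → Λ
  | skip, _, q => q
  | push _ _, e, _ => e ()
  | seq c d, e, q => entry c (fun l => e (.inl l)) (entry d (fun l => e (.inr l)) q)
  | case _ _, e, _ => e none
  | whl _ _ _, e, _ => e none

variable {K : Type} [DecidableEq K] {Γ : K → Type} {Λ σ : Type}

/-- The family of alphabets of the stacks of a machine with additional stacks. -/
@[reducible] def Alph (Γ : K → Type) (W G : Type) : K ⊕ W → Type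
  | .inl k => Γ k
  | .inr _ => G

/-- The stacks of a machine with additional stacks. -/
def stk (T : ∀ k, List (Γ k)) (S : W → List G) : ∀ k, List (Alph Γ W G k)
  | .inl k => T k
  | .inr w => S w

theorem update_stk_inl (T : ∀ k, List (Γ k)) (S : W → List G) (k : K) (a : List (Γ k)) :
    Function.update (stk T S) (.inl k) a = stk (Function.update T k a) S := by
  funext x
  rcases x with x | x
  · by_cases h : x = k
    · subst h; simp [stk]
    · rw [Function.update_of_ne (by simpa using h)]; simp [stk, Function.update_of_ne h]
  · rw [Function.update_of_ne (by simp)]; rfl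

theorem update_stk_inr (T : ∀ k, List (Γ k)) (S : W → List G) (w : W) (a : List G) :
    Function.update (stk T S) (.inr w) a = stk T (Function.update S w a) := by
  funext x
  rcases x with x | x
  · rw [Function.update_of_ne (by simp)]; rfl
  · by_cases h : x = w
    · subst h; simp [stk]
    · rw [Function.update_of_ne (by simpa using h)]; simp [stk, Function.update_of_ne h]

/-- The compiled program, with labels embedded by `e`, which jumps to `q` at the end. -/
def code : (c : Cmd W G) → (Lab c → Λ) → Λ → Lab c →
    TM2.Stmt (Alph Γ W G) Λ (σ × Option G)
  | push w g, _, q, _ => .push (.inr w) (fun _ => g) (.goto fun _ => q)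
  | seq c d, e, q, .inl l => code c (fun l => e (.inl l)) (entry d (fun l => e (.inr l)) q) l
  | seq _ d, e, q, .inr l => code d (fun l => e (.inr l)) q l
  | case w f, e, q, none => .pop (.inr w) (fun s o => (s.1, o))
      (.goto fun s => entry (f s.2) (fun l => e (some ⟨s.2, l⟩)) q)
  | case _ f, e, q, some ⟨o, l⟩ => code (f o) (fun l => e (some ⟨o, l⟩)) q l
  | whl w p f, e, q, none => .peek (.inr w) (fun s o => (s.1, o))
      (.branch (fun s => s.2.any p)
        (.pop (.inr w) (fun s _ => s)
          (.goto fun s => s.2.elim q fun g => entry (f g) (fun l => e (some ⟨g, l⟩)) (e none)))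
        (.goto fun _ => q))
  | whl _ _ f, e, _, some ⟨g, l⟩ => code (f g) (fun l => e (some ⟨g, l⟩)) (e none) l

end Cmd

open Cmd

/-! ### Compilation of stack programs, and machines with additional stacks -/

section Compile

variable {K : Type} [DecidableEq K] {Γ : K → Type} {Λ σ : Type}

/-- The clauses of `Run` charge exactly the transitions of the compiled code. The return label `q`
varies in the induction because a loop body returns to the head of its loop. The `Option G` register
only holds the last symbol inspected, so its final value is left open. -/
theorem Run.stepsTo {m : Λ → TM2.Stmt (Alph Γ W G) Λ (σ × Option G)} {c : Cmd W G}
    {S S' : W → List G} {t : ℕ} (h : Run c S S' t) (e : Lab c → Λ) (q : Λ)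
    (hm : ∀ l, m (e l) = code c e q l) (T : ∀ k, List (Γ k)) (v : σ) (o : Option G) :
    ∃ o', StepsTo m t ⟨some (entry c e q), (v, o), stk T S⟩ ⟨some q, (v, o'), stk T S'⟩ := by
  induction h generalizing q o with
  | skip S => exact ⟨o, .refl _⟩
  | push w g S =>
    refine ⟨o, .single ?_⟩
    rw [entry, hm ()]
    simp only [code, TM2.stepAux, update_stk_inr]
    rfl
  | @seq c d S S' S'' t t' _ _ ih ih' =>
    obtain ⟨o1, h1⟩ := ih (fun l => e (.inl l)) (entry d (fun l => e (.inr l)) q)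
      (fun l => hm (.inl l)) o
    obtain ⟨o2, h2⟩ := ih' (fun l => e (.inr l)) q (fun l => hm (.inr l)) o1
    exact ⟨o2, h1.trans h2⟩
  | @case w f S S' t _ ih =>
    obtain ⟨o1, h1⟩ := ih (fun l => e (some ⟨_, l⟩)) q (fun l => hm (some ⟨_, l⟩)) (S w).head?
    refine ⟨o1, StepsTo.trans (.single ?_) h1⟩
    rw [entry, hm none]
    simp only [code, TM2.stepAux, update_stk_inr]
    rfl
  | @whl_done w p f S hp =>
    refine ⟨(S w).head?, .single ?_⟩
    rw [entry, hm none]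
    simp only [code, TM2.stepAux]
    have : (stk T S (.inr w)).head?.any p = false := hp
    rw [this]
    rfl
  | @whl_step w p f S S' S'' g r t t' hw hg _ _ ih ih' =>
    obtain ⟨o1, h1⟩ := ih (fun l => e (some ⟨g, l⟩)) (e none) (fun l => hm (some ⟨g, l⟩)) (some g)
    obtain ⟨o2, h2⟩ := ih' e q hm o1
    refine ⟨o2, StepsTo.trans (StepsTo.trans (.single ?_) h1) h2⟩
    rw [entry, hm none]
    have hw' : stk T S (.inr w) = g :: r := hw
    simp only [code, TM2.stepAux, hw', update_stk_inr]
    simp [hg]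

/-- The statements of a machine `M` with additional stacks, which jumps to `q` where `M` halts. -/
def liftStmt (q : Λ') : TM2.Stmt Γ Λ σ → TM2.Stmt (Alph Γ W G) (Λ ⊕ Λ') (σ × Option G)
  | .push k f r => .push (.inl k) (fun s => f s.1) (liftStmt q r)
  | .peek k f r => .peek (.inl k) (fun s o => (f s.1 o, s.2)) (liftStmt q r)
  | .pop k f r => .pop (.inl k) (fun s o => (f s.1 o, s.2)) (liftStmt q r)
  | .load f r => .load (fun s => (f s.1, s.2)) (liftStmt q r)
  | .branch f r r' => .branch (fun s => f s.1) (liftStmt q r) (liftStmt q r')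
  | .goto f => .goto fun s => .inl (f s.1)
  | .halt => .goto fun _ => .inr q

/-- The configurations of a machine `M` with additional stacks, which jumps to `q` where `M`
halts. -/
def liftCfg {Λ' : Type} (q : Λ') (o : Option G) (S : W → List G) (c : TM2.Cfg Γ Λ σ) :
    TM2.Cfg (Alph Γ W G) (Λ ⊕ Λ') (σ × Option G) :=
  ⟨some (c.l.elim (.inr q) .inl), (c.var, o), stk c.stk S⟩

theorem stepAux_liftStmt {Λ' : Type} (q : Λ') (o : Option G) (S : W → List G)
    (r : TM2.Stmt Γ Λ σ) (v : σ) (T : ∀ k, List (Γ k)) :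
    TM2.stepAux (liftStmt q r) (v, o) (stk T S) = liftCfg q o S (TM2.stepAux r v T) := by
  induction r generalizing v T with
  | push k f r ih => simp only [liftStmt, TM2.stepAux, update_stk_inl]; exact ih _ _
  | peek k f r ih => simp only [liftStmt, TM2.stepAux]; exact ih _ _
  | pop k f r ih => simp only [liftStmt, TM2.stepAux, update_stk_inl]; exact ih _ _
  | load f r ih => simp only [liftStmt, TM2.stepAux]; exact ih _ _
  | branch f r r' ih ih' =>
    simp only [liftStmt, TM2.stepAux]
    cases f v
    · exact ih' _ _
    · exact ih _ _
  | goto f => rfl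
  | halt => rfl

/-- The statements of the old machine never touch the new stacks or the new register, and `liftCfg`
identifies a halted configuration with one waiting at `q`. -/
theorem StepsTo.lift {Λ' : Type} {m : Λ → TM2.Stmt Γ Λ σ} (q : Λ') (o : Option G)
    (S : W → List G) {m' : Λ ⊕ Λ' → TM2.Stmt (Alph Γ W G) (Λ ⊕ Λ') (σ × Option G)}
    (hm : ∀ l, m' (.inl l) = liftStmt q (m l)) {n : ℕ} {c c' : TM2.Cfg Γ Λ σ}
    (h : StepsTo m n c c') : StepsTo m' n (liftCfg q o S c) (liftCfg q o S c') := by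
  induction n generalizing c with
  | zero =>
    have : c = c' := Option.some.inj h
    subst this
    exact .refl _
  | succ n ih =>
    obtain ⟨l, hl, h⟩ := h.cases_succ
    rw [add_comm]
    refine StepsTo.trans (.single ?_) (ih h)
    rw [hl]
    simp only [Option.elim, hm, stepAux_liftStmt]

end Compile

/-! ### Running a program after a machine -/

open Function in
/-- The stacks all of which are empty, except for the stack `w`. -/
def single (w : W) (l : List G) : W → List G := update (fun _ => []) w l

section Append

/-- The labels which are used to continue the machine with the program `c`. -/
abbrev ContLab (c : Cmd W G) : Type := Bool ⊕ Lab c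

/-- The statements of the machine which runs `M`, moves the contents of its output stack to the
stack `inp` (which reverses them), and runs the program `c`. -/
def appendCode (M : FinTM2) (g₀ : G) (φ : M.Γ M.k₁ → G) (c : Cmd W G) (inp : W) :
    M.Λ ⊕ ContLab c → TM2.Stmt (Alph M.Γ W G) (M.Λ ⊕ ContLab c) (M.σ × Option G)
  | .inl l => liftStmt (.inl false) (M.m l)
  | .inr (.inl false) => .pop (.inl M.k₁) (fun s o => (s.1, o.map φ))
      (.branch (fun s => s.2.isSome)
        (.push (.inr inp) (fun s => s.2.getD g₀) (.goto fun _ => .inr (.inl false)))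
        (.goto fun _ => entry c (fun l => .inr (.inr l)) (.inr (.inl true))))
  | .inr (.inl true) => .load (fun _ => (M.initialState, none)) .halt
  | .inr (.inr l) => code c (fun l => .inr (.inr l)) (.inr (.inl true)) l

variable (M : FinTM2) (g₀ : G) (φ : M.Γ M.k₁ → G) (c : Cmd W G) (inp : W)

/-- One step per symbol and one to notice the empty stack. Moving a word between stacks reverses it,
so the program that follows has to accept reversed input. -/
theorem stepsTo_transfer (L : List (M.Γ M.k₁)) (S : W → List G) (o : Option G) :
    ∃ o', StepsTo (appendCode M g₀ φ c inp) (L.length + 1)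
      ⟨some (.inr (.inl false)), (M.initialState, o), stk (haltList M L).stk S⟩
      ⟨some (entry c (fun l => .inr (.inr l)) (.inr (.inl true))), (M.initialState, o'),
        stk (fun _ => []) (Function.update S inp ((L.map φ).reverse ++ S inp))⟩ := by
  have hk : ∀ L : List (M.Γ M.k₁), (haltList M L).stk M.k₁ = L := fun L => by simp [haltList]
  have hu : ∀ L L' : List (M.Γ M.k₁),
      Function.update (haltList M L).stk M.k₁ L' = (haltList M L').stk := by
    intro L L'
    funext k
    by_cases h : k = M.k₁
    · subst h; simp [haltList]
    · simp [haltList, h]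
  induction L generalizing S o with
  | nil =>
    refine ⟨none, .single ?_⟩
    have h0 : (haltList M []).stk = fun _ => [] := by
      funext k
      by_cases h : k = M.k₁
      · subst h; simp [haltList]
      · simp [haltList, h]
    have h1 : stk (haltList M []).stk S (.inl M.k₁) = [] := hk []
    simp only [appendCode, TM2.stepAux, h1, List.head?_nil, Option.map_none, Option.isSome_none,
      cond_false, List.tail_nil]
    rw [update_stk_inl, hu, h0]
    simp
  | cons a L ih =>
    obtain ⟨o', h⟩ := ih (Function.update S inp (φ a :: S inp)) (some (φ a))
    refine ⟨o', ?_⟩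
    rw [List.length_cons, add_comm]
    refine StepsTo.trans (.single ?_) (by simpa using h)
    have h1 : stk (haltList M (a :: L)).stk S (.inl M.k₁) = a :: L := hk _
    simp only [appendCode, TM2.stepAux, h1, List.head?_cons, Option.map_some,
      Option.isSome_some, cond_true, List.tail_cons, Option.getD_some]
    rw [update_stk_inl, hu, update_stk_inr]
    rfl

variable [Fintype W] [Fintype G]

/-- The machine which runs `M`, moves the contents of its output stack to the stack `inp` (which
reverses them), and runs the program `c` with output on the stack `out`. -/
noncomputable def appendProgram (M : FinTM2) (g₀ : G) (φ : M.Γ M.k₁ → G) (c : Cmd W G)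
    (inp out : W) : FinTM2 :=
  haveI := M.kFin
  haveI := M.ΛFin
  haveI := M.σFin
  letI := fintypeLab c
  { K := M.K ⊕ W
    k₀ := .inl M.k₀
    k₁ := .inr out
    Γ := Alph M.Γ W G
    Λ := M.Λ ⊕ ContLab c
    main := .inl M.main
    σ := M.σ × Option G
    initialState := (M.initialState, none)
    Γk₀Fin := M.Γk₀Fin
    m := appendCode M g₀ φ c inp }

variable (out : W)

theorem initList_appendProgram (L : List (M.Γ M.k₀)) :
    initList (appendProgram M g₀ φ c inp out) L =
      ⟨some (.inl M.main), (M.initialState, none), stk (initList M L).stk fun _ => []⟩ := by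
  unfold initList
  congr 1
  funext k
  rcases k with k | w
  · by_cases h : k = M.k₀
    · subst h; simp [appendProgram, stk]; rfl
    · simp [appendProgram, stk, h]
  · simp [appendProgram, stk]

theorem haltList_appendProgram (L : List G) :
    haltList (appendProgram M g₀ φ c inp out) L =
      ⟨none, (M.initialState, none), stk (fun _ => []) (single out L)⟩ := by
  unfold haltList
  congr 1
  funext k
  rcases k with k | w
  · simp [appendProgram, stk]
  · by_cases h : w = out
    · subst h; simp [appendProgram, stk, single]; rfl
    · simp [appendProgram, stk, single, h]

theorem stepsTo_appendProgram {n t : ℕ} {L : List (M.Γ M.k₀)} {L' : List (M.Γ M.k₁)}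
    {L'' : List G} (h : StepsTo M.m n (initList M L) (haltList M L'))
    (hc : Run c (single inp (L'.map φ).reverse) (single out L'') t) :
    StepsTo (appendProgram M g₀ φ c inp out).m (n + (L'.length + 1) + t + 1)
      (initList (appendProgram M g₀ φ c inp out) L)
      (haltList (appendProgram M g₀ φ c inp out) L'') := by
  rw [initList_appendProgram, haltList_appendProgram]
  have h1 := h.lift (m' := (appendProgram M g₀ φ c inp out).m) (.inl false) none (fun _ => [])
    (fun _ => rfl)
  obtain ⟨o, h2⟩ := stepsTo_transfer M g₀ φ c inp L' (fun _ => []) none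
  obtain ⟨o', h3⟩ := hc.stepsTo (m := (appendProgram M g₀ φ c inp out).m)
    (fun l => .inr (.inr l)) (.inr (.inl true)) (fun _ => rfl) (fun _ => []) M.initialState o
  rw [List.append_nil] at h2
  -- The final step resets the register, since `haltList` demands the initial internal state.
  exact ((h1.trans h2).trans h3).trans (.single rfl)

end Append

/-- A program which maps the reversed code of `b` to the code of `g b` in polynomial time can be
run after a machine which computes `f` in polynomial time. -/
theorem polyTime_comp {α β γ A : Type} [Fintype W] [Fintype G] [Nonempty G] {ea : α → List A}
    {eb : β → List G} {ec : γ → List G} {f : α → β} {g : β → γ} (c : Cmd W G) (inp out : W)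
    (P : Polynomial ℕ) (hc : ∀ b, ∃ t ≤ P.eval (eb b).length,
      Run c (single inp (eb b).reverse) (single out (ec (g b))) t)
    (hf : Nonempty (TM2ComputableInPolyTime ea eb f)) :
    Nonempty (TM2ComputableInPolyTime ea ec (g ∘ f)) := by
  obtain ⟨F⟩ := hf
  obtain ⟨g₀⟩ := ‹Nonempty G›
  have := F.tm.ΛFin
  obtain ⟨C, hC⟩ : ∃ C, ∀ l, numPush (F.tm.m l) ≤ C :=
    ⟨Finset.univ.sup fun l => numPush (F.tm.m l), fun l => Finset.le_sup (f := fun l =>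
      numPush (F.tm.m l)) (Finset.mem_univ l)⟩
  -- Bounds the length of the intermediate word: the output stack starts with at most the input, and
  -- each step adds at most `C` symbols.
  let Q : Polynomial ℕ := .X + .C C * F.time
  have key : ∀ a, ∃ n ≤ (F.time + (Q + 1) + P.comp Q + 1).eval (ea a).length,
      StepsTo (appendProgram F.tm g₀ F.outputAlphabet c inp out).m n
      (initList (appendProgram F.tm g₀ F.outputAlphabet c inp out)
        ((ea a).map F.inputAlphabet.symm))
      (haltList (appendProgram F.tm g₀ F.outputAlphabet c inp out) (ec (g (f a)))) := by
    intro a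
    obtain ⟨⟨n, hn⟩, hle⟩ := F.outputsFun a
    have hn' : StepsTo F.tm.m n (initList F.tm ((ea a).map F.inputAlphabet.symm))
      (haltList F.tm ((eb (f a)).map F.outputAlphabet.symm)) := hn
    obtain ⟨t, ht, hr⟩ := hc (f a)
    have hlen : (eb (f a)).length ≤ Q.eval (ea a).length := by
      have h1 := hn'.length_le hC F.tm.k₁
      have h2 : ((haltList F.tm ((eb (f a)).map F.outputAlphabet.symm)).stk F.tm.k₁).length =
        (eb (f a)).length := by simp [haltList]
      have h3 : ((initList F.tm ((ea a).map F.inputAlphabet.symm)).stk F.tm.k₁).length ≤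
          (ea a).length := by
        -- The input and output stacks may coincide, and then the input counts towards the initial
        -- height.
        by_cases h : F.tm.k₁ = F.tm.k₀
        · have : ∀ k (h : k = F.tm.k₀),
              ((initList F.tm ((ea a).map F.inputAlphabet.symm)).stk k).length ≤
              (ea a).length := by
            rintro k rfl
            simp [initList]
          exact this _ h
        · simp [initList, h]
      have h4 : C * n ≤ C * F.time.eval (ea a).length := Nat.mul_le_mul le_rfl hle
      simp only [Q, Polynomial.eval_add, Polynomial.eval_mul, Polynomial.eval_X,
        Polynomial.eval_C]
      omega
    refine ⟨_, ?_, stepsTo_appendProgram F.tm g₀ F.outputAlphabet c inp out hn'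
      (t := t) (by simpa [Function.comp_def] using hr)⟩
    have hP : P.eval (eb (f a)).length ≤ P.eval (Q.eval (ea a).length) := by
      have : Monotone fun n : ℕ => P.eval n := fun m n h => by
        simp only [Polynomial.eval_eq_sum, Polynomial.sum]
        gcongr
      exact this hlen
    simp only [List.length_map, Polynomial.eval_add, Polynomial.eval_comp, Polynomial.eval_one]
    have hle' : n ≤ F.time.eval (ea a).length := hle
    omega
  choose n hn hs using key
  exact ⟨{
    tm := appendProgram F.tm g₀ F.outputAlphabet c inp out
    inputAlphabet := F.inputAlphabet
    outputAlphabet := Equiv.refl G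
    time := F.time + (Q + 1) + P.comp Q + 1
    outputsFun := fun a => ⟨⟨n a, Eq.trans (hs a) (congrArg (fun l => some (haltList
      (appendProgram F.tm g₀ F.outputAlphabet c inp out) l)) (List.map_id _).symm)⟩, hn a⟩ }⟩

end StackProgram

/-! ### The concrete stacks, and a calculus of time-bounded runs -/

namespace StackProgram

open Cmd

/-! ### The stacks of the reduction -/

/-- The symbols on the tapes for instances over the alphabet `{0, 1, #}`. -/
abbrev Sym : Type := Option (Option Bool)

/-- The separator in the code of an instance. -/
abbrev sP : Sym := none

/-- The end of a word. -/
abbrev sH : Sym := some none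

/-- The symbol for a bit. -/
abbrev bit (b : Bool) : Sym := some (some b)

/-- The symbol `1`. -/
abbrev sT : Sym := bit true

/-- Names of the stacks. -/
inductive Stk
  | raw | inp | par | cap | bad | n | nd | nr | k | kd | fam | row | rowr | y | y2 | m | pc | tmp | out
  deriving DecidableEq

instance : Fintype Stk where
  elems := {.raw, .inp, .par, .cap, .bad, .n, .nd, .nr, .k, .kd, .fam, .row, .rowr, .y, .y2, .m,
    .pc, .tmp, .out}
  complete w := by cases w <;> decide

/-- The contents of the stacks. -/
structure Stacks where
  raw : List Sym := []
  inp : List Sym := []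
  par : List Sym := []
  cap : List Sym := []
  bad : List Sym := []
  n : List Sym := []
  nd : List Sym := []
  nr : List Sym := []
  k : List Sym := []
  kd : List Sym := []
  fam : List Sym := []
  row : List Sym := []
  rowr : List Sym := []
  y : List Sym := []
  y2 : List Sym := []
  m : List Sym := []
  pc : List Sym := []
  tmp : List Sym := []
  out : List Sym := []

namespace Stacks

/-- The contents of the stack `w`. -/
def get (s : Stacks) : Stk → List Sym
  | .raw => s.raw
  | .inp => s.inp
  | .par => s.par
  | .cap => s.cap
  | .bad => s.bad
  | .n => s.n
  | .nd => s.nd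
  | .nr => s.nr
  | .k => s.k
  | .kd => s.kd
  | .fam => s.fam
  | .row => s.row
  | .rowr => s.rowr
  | .y => s.y
  | .y2 => s.y2
  | .m => s.m
  | .pc => s.pc
  | .tmp => s.tmp
  | .out => s.out

/-- Replace the contents of the stack `w`. -/
def set (s : Stacks) (w : Stk) (l : List Sym) : Stacks :=
  match w with
  | .raw => { s with raw := l }
  | .inp => { s with inp := l }
  | .par => { s with par := l }
  | .cap => { s with cap := l }
  | .bad => { s with bad := l }
  | .n => { s with n := l }
  | .nd => { s with nd := l }
  | .nr => { s with nr := l }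
  | .k => { s with k := l }
  | .kd => { s with kd := l }
  | .fam => { s with fam := l }
  | .row => { s with row := l }
  | .rowr => { s with rowr := l }
  | .y => { s with y := l }
  | .y2 => { s with y2 := l }
  | .m => { s with m := l }
  | .pc => { s with pc := l }
  | .tmp => { s with tmp := l }
  | .out => { s with out := l }

theorem get_set (s : Stacks) (w : Stk) (l : List Sym) :
    (s.set w l).get = Function.update s.get w l := by
  funext v
  by_cases h : v = w
  · subst h
    rw [Function.update_self]
    cases v <;> rfl
  · rw [Function.update_of_ne h]
    cases w <;> cases v <;> first | rfl | exact absurd rfl h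

theorem get_set_self (s : Stacks) (w : Stk) (l : List Sym) : (s.set w l).get w = l := by
  rw [get_set, Function.update_self]

theorem get_set_of_ne (s : Stacks) {w v : Stk} (h : v ≠ w) (l : List Sym) :
    (s.set w l).get v = s.get v := by
  rw [get_set, Function.update_of_ne h]

/-- Reduces identities between records of stacks to identities between functions, where the rules
for `Function.update` apply. -/
theorem get_injective : Function.Injective get := by
  rintro ⟨⟩ ⟨⟩ h
  simp only [mk.injEq]
  exact ⟨congrFun h .raw, congrFun h .inp, congrFun h .par, congrFun h .cap, congrFun h .bad,
    congrFun h .n, congrFun h .nd, congrFun h .nr, congrFun h .k, congrFun h .kd, congrFun h .fam,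
    congrFun h .row, congrFun h .rowr, congrFun h .y, congrFun h .y2, congrFun h .m,
    congrFun h .pc, congrFun h .tmp, congrFun h .out⟩

theorem set_set (s : Stacks) (w : Stk) (l l' : List Sym) : (s.set w l).set w l' = s.set w l' :=
  get_injective (by simp [get_set])

theorem set_comm (s : Stacks) {w v : Stk} (h : w ≠ v) (l l' : List Sym) :
    (s.set w l).set v l' = (s.set v l').set w l :=
  get_injective (by simp only [get_set]; exact Function.update_comm h _ _ _)

theorem set_get (s : Stacks) (w : Stk) : s.set w (s.get w) = s :=
  get_injective (by simp [get_set])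

end Stacks

/-- The program `c` goes from `s` to `s'` in at most `b` steps. -/
def R (c : Cmd Stk Sym) (s s' : Stacks) (b : ℕ) : Prop := ∃ t ≤ b, Run c s.get s'.get t

namespace R

variable {c d : Cmd Stk Sym} {s s' s'' : Stacks} {a b : ℕ}

theorem mono (h : R c s s' a) (hab : a ≤ b) : R c s s' b :=
  let ⟨t, ht, hr⟩ := h
  ⟨t, ht.trans hab, hr⟩

theorem cast (h : R c s s' a) (hs : s' = s'') (hab : a ≤ b) : R c s s'' b := hs ▸ h.mono hab

theorem skip (s : Stacks) : R .skip s s 0 := ⟨0, le_rfl, .skip _⟩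

theorem push (w : Stk) (g : Sym) (s : Stacks) : R (.push w g) s (s.set w (g :: s.get w)) 1 :=
  ⟨1, le_rfl, by rw [Stacks.get_set]; exact .push _ _ _⟩

theorem seq (h : R c s s' a) (h' : R d s' s'' b) : R (c ;; d) s s'' (a + b) :=
  let ⟨_, ht, hr⟩ := h
  let ⟨_, ht', hr'⟩ := h'
  ⟨_, add_le_add ht ht', .seq hr hr'⟩

theorem case {w : Stk} {f : Option Sym → Cmd Stk Sym} {l : List Sym} (hl : s.get w = l)
    (h : R (f l.head?) (s.set w l.tail) s' a) : R (.case w f) s s' (1 + a) := by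
  subst hl
  obtain ⟨t, ht, hr⟩ := h
  rw [Stacks.get_set] at hr
  exact ⟨_, Nat.add_le_add_left ht 1, .case hr⟩

/-- Here `l` is the list of symbols consumed by the loop, possibly only the top part of the stack,
and `st i` describes the stacks after `i` rounds. -/
theorem whl {w : Stk} {p : Sym → Bool} {f : Sym → Cmd Stk Sym} (l : List Sym) (st : ℕ → Stacks)
    (hstep : ∀ i (h : i < l.length), ∃ r, (st i).get w = l[i] :: r ∧ p l[i] = true ∧
      R (f l[i]) ((st i).set w r) (st (i + 1)) b)
    (hend : ((st l.length).get w).head?.any p = false) :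
    R (.whl w p f) (st 0) (st l.length) (l.length * (b + 1) + 1) := by
  induction l generalizing st with
  | nil => exact ⟨1, by simp, .whl_done hend⟩
  | cons g l ih =>
    obtain ⟨t, ht, hr⟩ := ih (fun i => st (i + 1))
      (fun i h => hstep (i + 1) (Nat.succ_lt_succ h)) hend
    obtain ⟨r, h1, h2, t', ht', hr'⟩ := hstep 0 (Nat.succ_pos _)
    refine ⟨1 + t' + t, ?_, .whl_step h1 h2 ?_ hr⟩
    · simp only [List.length_cons, Nat.add_mul]
      omega
    · rwa [Stacks.get_set] at hr'

end R

/-! ### Simple programs -/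

/-- Pop all symbols of the stack `w` and run `f` on each of them. -/
def drain (w : Stk) (f : Sym → Cmd Stk Sym) : Cmd Stk Sym := .whl w (fun _ => true) f

/-- Move the contents of the stack `w` to the stack `v`. -/
def move (w v : Stk) : Cmd Stk Sym := drain w (.push v)

/-- Empty the stack `w`. -/
def clear (w : Stk) : Cmd Stk Sym := drain w fun _ => .skip

/-- Push `i` copies of the symbol `g`. -/
def pushN (w : Stk) (g : Sym) : ℕ → Cmd Stk Sym
  | 0 => .skip
  | i + 1 => pushN w g i ;; .push w g

/-- Push as many symbols `1` on `o` as there are symbols on `w`. -/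
def copy (w o : Stk) : Cmd Stk Sym := move w .tmp ;; drain .tmp fun g => .push w g ;; .push o sT

namespace R

variable {s s' : Stacks} {b : ℕ}

theorem drain {w : Stk} {f : Sym → Cmd Stk Sym} (l : List Sym) (st : ℕ → Stacks)
    (hstep : ∀ i (h : i < l.length), ∃ r, (st i).get w = l[i] :: r ∧
      R (f l[i]) ((st i).set w r) (st (i + 1)) b)
    (hend : (st l.length).get w = []) :
    R (drain w f) (st 0) (st l.length) (l.length * (b + 1) + 1) :=
  whl l st (fun i h => let ⟨r, h1, h2⟩ := hstep i h; ⟨r, h1, rfl, h2⟩) (by rw [hend]; rfl)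

theorem whl_push {w v : Stk} (hwv : w ≠ v) (p : Sym → Bool) (h : Sym → Sym) {l r : List Sym}
    (hl : ∀ g ∈ l, p g = true) (hr : r.head?.any p = false) (s : Stacks)
    (hs : s.get w = l ++ r) :
    R (.whl w p fun g => .push v (h g)) s
      ((s.set w r).set v ((l.map h).reverse ++ s.get v)) (l.length * 2 + 1) := by
  induction l generalizing s with
  | nil =>
    refine ⟨1, by simp, ?_⟩
    have : (s.set w r).set v (([].map h).reverse ++ s.get v) = s := by
      have : r = s.get w := by simpa using hs.symm
      rw [this, Stacks.set_get]
      simp [Stacks.set_get]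
    rw [this]
    refine .whl_done ?_
    rw [hs]
    exact hr
  | cons g l ih =>
    obtain ⟨t, ht, hrun⟩ := ih (fun x hx => hl x (List.mem_cons_of_mem _ hx))
      ((s.set w (l ++ r)).set v (h g :: s.get v))
      (by rw [Stacks.get_set_of_ne _ hwv, Stacks.get_set_self])
    refine ⟨1 + 1 + t, by simp; omega, .whl_step hs (hl g (by simp)) ?_ (S' := ?_) ?_⟩
    · exact ((s.set w (l ++ r)).set v (h g :: s.get v)).get
    · rw [Stacks.get_set, Stacks.get_set]
      have := Run.push v (h g) (Function.update s.get w (l ++ r))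
      rwa [Function.update_of_ne hwv.symm] at this
    · rw [Stacks.get_set_self, Stacks.set_comm _ hwv.symm, Stacks.set_set, Stacks.set_set] at hrun
      simpa using hrun

theorem drain_push {w v : Stk} (hwv : w ≠ v) (h : Sym → Sym) (s : Stacks) :
    R (StackProgram.drain w fun g => .push v (h g)) s
      ((s.set w []).set v (((s.get w).map h).reverse ++ s.get v)) ((s.get w).length * 2 + 1) :=
  whl_push hwv _ h (fun _ _ => rfl) rfl s (by simp)

theorem move {w v : Stk} (hwv : w ≠ v) (s : Stacks) :
    R (move w v) s ((s.set w []).set v ((s.get w).reverse ++ s.get v))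
      ((s.get w).length * 2 + 1) := by
  have := drain_push hwv id s
  rwa [List.map_id] at this

theorem clear (w : Stk) (s : Stacks) : R (clear w) s (s.set w []) ((s.get w).length + 1) := by
  have h := R.drain (b := 0) (f := fun _ => .skip) (w := w) (s.get w)
    (fun i => s.set w ((s.get w).drop i))
    (fun i hi => ⟨(s.get w).drop (i + 1), by
      rw [Stacks.get_set_self, List.drop_eq_getElem_cons hi], by
      rw [Stacks.set_set]
      exact R.skip _⟩) (by rw [Stacks.get_set_self, List.drop_length])
  rw [List.drop_zero, Stacks.set_get, List.drop_length] at h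
  exact h.mono (by omega)

theorem pushN (w : Stk) (g : Sym) (i : ℕ) (s : Stacks) :
    R (pushN w g i) s (s.set w (List.replicate i g ++ s.get w)) i := by
  induction i with
  | zero =>
    have e : s.set w (List.replicate 0 g ++ s.get w) = s := Stacks.set_get s w
    rw [e]
    exact R.skip s
  | succ i ih =>
    have := ih.seq (R.push w g _)
    rwa [Stacks.set_set, Stacks.get_set_self, ← List.cons_append, ← List.replicate_succ] at this

theorem copy {w o : Stk} (hwo : w ≠ o) (hw : w ≠ .tmp) (ho : o ≠ .tmp) (s : Stacks)
    (ht : s.get .tmp = []) :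
    R (copy w o) s (s.set o (List.replicate (s.get w).length sT ++ s.get o))
      ((s.get w).length * 5 + 2) := by
  set l := s.get w with hl
  -- After `i` rounds of the second loop, the last `i` symbols of the original stack are back on
  -- `w`, and `o` has gained `i` ones.
  let st : ℕ → Stacks := fun i => ((s.set .tmp (l.reverse.drop i)).set w (l.drop (l.length - i))).set
    o (List.replicate i sT ++ s.get o)
  have h1 : R (StackProgram.move w .tmp) s (st 0) (l.length * 2 + 1) := by
    have := R.move hw s
    rw [ht, List.append_nil, ← hl] at this
    have e : st 0 = (s.set w []).set .tmp l.reverse := by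
      simp only [st, List.drop_zero, Nat.sub_zero, List.drop_length, List.replicate_zero,
        List.nil_append]
      apply Stacks.get_injective
      funext v
      simp only [Stacks.get_set, Function.update_apply]
      split_ifs <;> simp_all
    rwa [e]
  have h2 := R.drain (b := 2) (w := .tmp) (f := fun g => .push w g ;; .push o sT) l.reverse st
    (fun i hi => ⟨l.reverse.drop (i + 1), by
      simp only [st]
      rw [Stacks.get_set_of_ne _ ho.symm, Stacks.get_set_of_ne _ hw.symm, Stacks.get_set_self,
        List.drop_eq_getElem_cons hi], by
      have := (R.push w l.reverse[i] ((st i).set .tmp (l.reverse.drop (i + 1)))).seq (R.push o sT _)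
      convert this using 1
      have hi' : i < l.length := by simpa using hi
      have e : l.drop (l.length - (i + 1)) = l.reverse[i] :: l.drop (l.length - i) := by
        rw [List.drop_eq_getElem_cons (by omega), List.getElem_reverse]
        congr 2 <;> omega
      apply Stacks.get_injective
      funext v
      simp only [st, Stacks.get_set, Function.update_apply]
      split_ifs <;> simp_all [List.replicate_succ]⟩) (by
      simp only [st]
      rw [Stacks.get_set_of_ne _ ho.symm, Stacks.get_set_of_ne _ hw.symm, Stacks.get_set_self,
        List.drop_length])
  have e : st l.reverse.length = s.set o (List.replicate l.length sT ++ s.get o) := by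
    apply Stacks.get_injective
    funext v
    simp only [st, List.length_reverse, Stacks.get_set, Function.update_apply]
    split_ifs <;> simp_all
  rw [e] at h2
  exact (h1.seq h2).mono (by simp; omega)

end R

end StackProgram

namespace StackProgram

open Cmd

/-! ### Writing edges -/

/-- The code of a number. -/
def encodeNum (a : ℕ) : List Sym := List.replicate a sT ++ [sH]

/-- The code of a list of edges. -/
def encodeEdges (E : List (ℕ × ℕ)) : List Sym :=
  E.flatMap fun e => encodeNum e.1 ++ encodeNum e.2

/-- A number which is given as the sum of the heights of some stacks and a constant. -/
abbrev Ref : Type := List Stk × ℕ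

/-- The number which is described by `r`. -/
def Ref.val (s : Stacks) (r : Ref) : ℕ := r.2 + (r.1.map fun w => (s.get w).length).sum

/-- Write `#`, and then the heights of some stacks in unary. -/
def emitHeights : List Stk → Cmd Stk Sym
  | [] => .push .out sH
  | w :: ws => emitHeights ws ;; copy w .out

/-- Write a number. -/
def emitNum (r : Ref) : Cmd Stk Sym := emitHeights r.1 ;; pushN .out sT r.2

/-- Write a list of edges. -/
def emitEdges : List (Ref × Ref) → Cmd Stk Sym
  | [] => .skip
  | e :: l => emitEdges l ;; emitNum e.2 ;; emitNum e.1

/-- The conditions on a description of a number under which it can be written in time `20 * T`. -/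
def Ref.Small (s : Stacks) (T : ℕ) (r : Ref) : Prop :=
  r.1.length ≤ 2 ∧ r.2 ≤ 7 ∧ ∀ w ∈ r.1, w ≠ .out ∧ w ≠ .tmp ∧ (s.get w).length ≤ T

namespace R

variable {s s' : Stacks} {T : ℕ}

theorem emitHeights (ws : List Stk) (ht : s.get .tmp = [])
    (hw : ∀ w ∈ ws, w ≠ .out ∧ w ≠ .tmp ∧ (s.get w).length ≤ T) :
    R (emitHeights ws) s (s.set .out
      (List.replicate (ws.map fun w => (s.get w).length).sum sT ++ sH :: s.get .out))
      (ws.length * (5 * T + 2) + 1) := by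
  induction ws with
  | nil => exact (R.push .out sH s).mono (by simp)
  | cons w ws ih =>
    obtain ⟨h1, h2, h3⟩ := hw w (by simp)
    have h := (ih fun v hv => hw v (by simp [hv])).seq
      (R.copy h1 h2 (by decide) _ (by rw [Stacks.get_set_of_ne _ (by decide)]; exact ht))
    refine h.cast ?_ ?_
    · rw [Stacks.set_set, Stacks.get_set_self, Stacks.get_set_of_ne _ h1, ← List.append_assoc,
        List.replicate_append_replicate]
      simp
    · rw [Stacks.get_set_of_ne _ h1]
      simp only [List.length_cons, Nat.add_mul]
      omega

theorem emitNum (r : Ref) (ht : s.get .tmp = []) (hr : r.Small s T) (hT : 1 ≤ T) :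
    R (emitNum r) s (s.set .out (encodeNum (r.val s) ++ s.get .out)) (25 * T) := by
  refine ((R.emitHeights r.1 ht hr.2.2).seq (R.pushN .out sT r.2 _)).cast ?_ ?_
  · rw [Stacks.set_set, Stacks.get_set_self, ← List.append_assoc,
      List.replicate_append_replicate]
    simp [encodeNum, Ref.val]
  · have h1 := Nat.mul_le_mul_right (5 * T + 2) hr.1
    have h2 := hr.2.1
    omega

theorem _root_.StackProgram.Ref.Small.set_out {r : Ref} (hr : r.Small s T) (l : List Sym) :
    r.Small (s.set .out l) T :=
  ⟨hr.1, hr.2.1, fun w hw => by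
    obtain ⟨h1, h2, h3⟩ := hr.2.2 w hw
    exact ⟨h1, h2, by rwa [Stacks.get_set_of_ne _ h1]⟩⟩

theorem _root_.StackProgram.Ref.Small.val_set_out {r : Ref} (hr : r.Small s T) (l : List Sym) :
    r.val (s.set .out l) = r.val s := by
  unfold Ref.val
  congr 2
  refine List.map_congr_left fun w hw => ?_
  rw [Stacks.get_set_of_ne _ (hr.2.2 w hw).1]

/-- The word on the output stack grows at its front, so the program writes the last edge first and
the second endpoint before the first. The values may all be taken in `s` because no reference reads
the output stack. -/
theorem emitEdges (l : List (Ref × Ref)) {E : List (ℕ × ℕ)} (ht : s.get .tmp = [])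
    (hE : s.get .out = encodeEdges E) (hl : ∀ e ∈ l, e.1.Small s T ∧ e.2.Small s T)
    (hT : 1 ≤ T) :
    R (emitEdges l) s
      (s.set .out (encodeEdges (l.map (fun e => (e.1.val s, e.2.val s)) ++ E)))
      (l.length * (50 * T)) := by
  induction l with
  | nil =>
    refine (R.skip s).cast ?_ (by simp)
    rw [List.map_nil, List.nil_append, ← hE, Stacks.set_get]
  | cons e l ih =>
    obtain ⟨h1, h2⟩ := hl e (by simp)
    have ht' : ∀ x, (s.set .out x).get .tmp = [] := fun x => by
      rw [Stacks.get_set_of_ne _ (by decide)]; exact ht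
    have h3 := R.emitNum e.2 (ht' _) (h2.set_out _) hT
      (s := s.set .out (encodeEdges (l.map (fun e => (e.1.val s, e.2.val s)) ++ E)))
    rw [h2.val_set_out, Stacks.set_set, Stacks.get_set_self] at h3
    have h4 := R.emitNum e.1 (ht' _) (h1.set_out _) hT (s := s.set .out (encodeNum (e.2.val s) ++
      encodeEdges (l.map (fun e => (e.1.val s, e.2.val s)) ++ E)))
    rw [h1.val_set_out, Stacks.set_set, Stacks.get_set_self] at h4
    refine ((ih fun e he => hl e (by simp [he])).seq (h3.seq h4)).cast ?_ ?_
    · simp [encodeEdges]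
    · simp only [List.length_cons, Nat.add_mul]
      omega

end R

/-- Keeps running times in the form `c * T ^ d`: one more level of looping raises the constant and
the exponent by one each. -/
theorem loop_time {a b c d T : ℕ} (hT : 1 ≤ T) (ha : a ≤ T) (hb : b + 1 ≤ c * T ^ d) :
    a * (b + 1) + 1 ≤ (c + 1) * T ^ (d + 1) := by
  have h1 : a * (b + 1) ≤ T * (c * T ^ d) := Nat.mul_le_mul ha hb
  have h2 : 1 ≤ T ^ (d + 1) := Nat.one_le_pow _ _ hT
  calc a * (b + 1) + 1 ≤ T * (c * T ^ d) + T ^ (d + 1) := by omega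
    _ = (c + 1) * T ^ (d + 1) := by ring

/-! ### The variable gadgets -/

/-- The concatenation `f (i - 1) ++ ⋯ ++ f 0`. -/
def accum {X : Type} (f : ℕ → List X) : ℕ → List X
  | 0 => []
  | i + 1 => f i ++ accum f i

theorem length_accum_le {X : Type} {f : ℕ → List X} {c : ℕ} (hf : ∀ i, (f i).length ≤ c) (i : ℕ) :
    (accum f i).length ≤ i * c := by
  induction i with
  | zero => simp [accum]
  | succ i ih =>
    have := hf i
    simp only [accum, List.length_append, Nat.add_mul]
    omega

/-- A number in unary on a stack. -/
abbrev num (a : ℕ) : List Sym := List.replicate a sT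

/-- The edges between the vertices of one variable, and to the terminals. -/
def gadgetEdges (v : ℕ) : List (ℕ × ℕ) :=
  [(4 + v, 5 + v), (6 + v, 4 + v), (6 + v, 5 + v), (7 + v, 4 + v), (7 + v, 5 + v), (6 + v, 7 + v),
    (6 + v, 0), (6 + v, 1), (7 + v, 2), (7 + v, 3)]

/-- The edges between a variable and the next `a` variables. -/
def conflictEdges (v a : ℕ) : List (ℕ × ℕ) := accum (fun d => [(7 + v, 7 + (v + 4 * (d + 1)))]) a

/-- The edges which are written for the variables. -/
def varEdges (n k : ℕ) : List (ℕ × ℕ) :=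
  accum (fun j => accum (fun u => conflictEdges (4 * (n * j + u)) (n - (u + 1)) ++
    gadgetEdges (4 * (n * j + u))) n) k

/-- The program which writes the edges between a variable and the following ones. -/
def conflictLoop : Cmd Stk Sym :=
  drain .n fun g => .push .nr g ;; pushN .y2 sT 4 ;; emitEdges [(([.y], 7), ([.y2], 7))]

/-- The program which writes `gadgetEdges`. -/
def gadgetProgram : Cmd Stk Sym := emitEdges
  [(([.y], 4), ([.y], 5)), (([.y], 6), ([.y], 4)), (([.y], 6), ([.y], 5)), (([.y], 7), ([.y], 4)),
    (([.y], 7), ([.y], 5)), (([.y], 6), ([.y], 7)), (([.y], 6), ([], 0)), (([.y], 6), ([], 1)),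
    (([.y], 7), ([], 2)), (([.y], 7), ([], 3))]

/-- The program for one variable. -/
def varBody : Cmd Stk Sym :=
  gadgetProgram ;; copy .y .y2 ;; conflictLoop ;; move .nr .n ;; clear .y2 ;; pushN .y sT 4

/-- The program for all variables. -/
def varLoop : Cmd Stk Sym :=
  drain .k (fun g => .push .kd g ;; drain .n (fun g => .push .nd g ;; varBody) ;; move .nd .n) ;;
    move .kd .k

section Var

variable {T : ℕ}

/-- The stack `n` holds one symbol for each later variable of the same row; `y2` runs through their
offsets while `y` stays at `v`. -/
theorem conflictLoop_spec (hT : 1 ≤ T) {a v : ℕ} {nd k kd fam : List Sym} {E : List (ℕ × ℕ)} (ha : a ≤ T)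
    (hv : v + 4 * a ≤ T) :
    R conflictLoop
      { n := num a, nd := nd, k := k, kd := kd, fam := fam, y := num v, y2 := num v,
        out := encodeEdges E }
      { nd := nd, nr := num a, k := k, kd := kd, fam := fam, y := num v, y2 := num (v + 4 * a),
        out := encodeEdges (conflictEdges v a ++ E) }
      (57 * T ^ 2) := by
  let st : ℕ → Stacks := fun d =>
    { n := num (a - d), nd := nd, nr := num d, k := k, kd := kd, fam := fam, y := num v,
      y2 := num (v + 4 * d), out := encodeEdges (conflictEdges v d ++ E) }
  have h := R.drain (w := .n) (b := 1 + (4 + 1 * (50 * T)))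
    (f := fun g => .push .nr g ;; pushN .y2 sT 4 ;; emitEdges [(([.y], 7), ([.y2], 7))])
    (num a) st ?_ ?_
  · simp only [List.length_replicate] at h
    exact h.cast (by simp [st]) (loop_time (c := 56) (d := 1) hT ha (by rw [pow_one]; omega))
  · intro d hd
    have hd' : d < a := by simpa using hd
    refine ⟨num (a - (d + 1)), ?_, ?_⟩
    · have : a - d = a - (d + 1) + 1 := by omega
      simp only [List.getElem_replicate, st, Stacks.get]
      rw [this]
      rfl
    · simp only [List.getElem_replicate]
      refine ((R.push .nr sT _).seq ((R.pushN .y2 sT 4 _).seq (R.emitEdges _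
        (E := conflictEdges v d ++ E) rfl rfl (T := T) ?_ hT))).cast ?_ le_rfl
      · simp [Ref.Small, st, Stacks.set, Stacks.get]
        omega
      · simp only [st, Stacks.set, Stacks.get, Ref.val, conflictEdges, accum]
        simp
        exact ⟨rfl, rfl, rfl⟩
  · simp [st, Stacks.get]

theorem varBody_spec (hT : 1 ≤ T) {a v : ℕ} {nd k kd fam : List Sym} {E : List (ℕ × ℕ)}
    (ha : a ≤ T) (hv : v + 4 * a ≤ T) :
    R varBody
      { n := num a, nd := nd, k := k, kd := kd, fam := fam, y := num v, out := encodeEdges E }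
      { n := num a, nd := nd, k := k, kd := kd, fam := fam, y := num (v + 4),
        out := encodeEdges (conflictEdges v a ++ gadgetEdges v ++ E) }
      (600 * T ^ 2) := by
  have h1 : R gadgetProgram
      { n := num a, nd := nd, k := k, kd := kd, fam := fam, y := num v, out := encodeEdges E }
      { n := num a, nd := nd, k := k, kd := kd, fam := fam, y := num v,
        out := encodeEdges (gadgetEdges v ++ E) } (10 * (50 * T)) := by
    refine (R.emitEdges _ (E := E) rfl rfl (T := T) ?_ hT).cast ?_ le_rfl
    · simp [Ref.Small, Stacks.get]
      omega
    · simp [Ref.val, Stacks.get, Stacks.set, gadgetEdges]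
  have h2 := R.copy (w := .y) (o := .y2) (by decide) (by decide) (by decide)
    { n := num a, nd := nd, k := k, kd := kd, fam := fam, y := num v,
      out := encodeEdges (gadgetEdges v ++ E) } rfl
  simp only [Stacks.get, Stacks.set, List.length_replicate, List.append_nil] at h2
  have h3 := conflictLoop_spec hT (nd := nd) (k := k) (kd := kd) (fam := fam)
    (E := gadgetEdges v ++ E) ha hv
  refine (h1.seq (h2.seq (h3.seq ((R.move (w := .nr) (v := .n) (by decide) _).seq
    ((R.clear .y2 _).seq (R.pushN .y sT 4 _)))))).cast ?_ ?_
  · simp [Stacks.get, Stacks.set]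
    rfl
  · simp only [Stacks.get, Stacks.set, List.length_replicate]
    have : T ≤ T ^ 2 := Nat.le_self_pow (by norm_num) T
    omega

/-- The stack `y` is not reset between rows, so its height is always the offset of the current
variable. Its final height `4 * (n * k)` later provides the number of the first path vertex. -/
theorem varLoop_spec (hT : 1 ≤ T) {n k : ℕ} {fam : List Sym} {E : List (ℕ × ℕ)} (hn : n ≤ T)
    (hk : k ≤ T) (hnk : 4 * (n * k) ≤ T) :
    R varLoop
      { n := num n, k := num k, fam := fam, out := encodeEdges E }
      { n := num n, k := num k, fam := fam, y := num (4 * (n * k)),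
        out := encodeEdges (varEdges n k ++ E) }
      (612 * T ^ 4) := by
  have hT2 : T ≤ T ^ 2 := Nat.le_self_pow (by norm_num) T
  have hT3 : T ≤ T ^ 3 := Nat.le_self_pow (by norm_num) T
  have hT4 : T ≤ T ^ 4 := Nat.le_self_pow (by norm_num) T
  let g : ℕ → ℕ → List (ℕ × ℕ) := fun j u => conflictEdges (4 * (n * j + u)) (n - (u + 1)) ++
    gadgetEdges (4 * (n * j + u))
  have inner : ∀ j < k, ∀ E, R (drain .n fun g => .push .nd g ;; varBody)
      { n := num n, k := num (k - (j + 1)), kd := num (j + 1), fam := fam, y := num (4 * (n * j)),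
        out := encodeEdges E }
      { nd := num n, k := num (k - (j + 1)), kd := num (j + 1), fam := fam,
        y := num (4 * (n * (j + 1))), out := encodeEdges (accum (g j) n ++ E) }
      (603 * T ^ 3) := by
    intro j hj E
    let st : ℕ → Stacks := fun u =>
      { n := num (n - u), nd := num u, k := num (k - (j + 1)), kd := num (j + 1), fam := fam,
        y := num (4 * (n * j + u)), out := encodeEdges (accum (g j) u ++ E) }
    have h := R.drain (w := .n) (b := 1 + 600 * T ^ 2) (f := fun g => .push .nd g ;; varBody)
      (num n) st ?_ ?_
    · simp only [List.length_replicate] at h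
      exact h.cast (by simp [st, mul_add]) (loop_time (c := 602) hT hn (by omega))
    · intro u hu
      have hu' : u < n := by simpa using hu
      refine ⟨num (n - (u + 1)), ?_, ?_⟩
      · have : n - u = n - (u + 1) + 1 := by omega
        simp only [List.getElem_replicate, st, Stacks.get]
        rw [this]
        rfl
      · simp only [List.getElem_replicate]
        -- The last variable of row `j` has offset `4 * (n * j + n - 1)`, which is below `4 * (n *
        -- k)`.
        have hv : 4 * (n * j + u) + 4 * (n - (u + 1)) ≤ T := by
          have : n * (j + 1) ≤ n * k := Nat.mul_le_mul le_rfl hj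
          rw [mul_add] at this
          omega
        refine ((R.push .nd sT _).seq (varBody_spec hT (a := n - (u + 1)) (v := 4 * (n * j + u))
          (nd := num (u + 1)) (E := accum (g j) u ++ E) (by omega) hv)).cast ?_ le_rfl
        simp only [st, accum, List.append_assoc, g]
        rfl
    · simp [st, Stacks.get]
  let st : ℕ → Stacks := fun j =>
    { n := num n, k := num (k - j), kd := num j, fam := fam,
      y := num (4 * (n * j)), out := encodeEdges (varEdges n j ++ E) }
  have h := R.drain (w := .k) (b := 1 + (603 * T ^ 3 + (T * 2 + 1)))
    (f := fun g => .push .kd g ;; drain .n (fun g => .push .nd g ;; varBody) ;; move .nd .n)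
    (num k) st ?_ ?_
  · simp only [List.length_replicate] at h
    refine ((h.mono (loop_time (c := 608) (d := 3) hT hk (by omega))).seq
      (R.move (w := .kd) (v := .k) (by decide) _)).cast ?_ ?_
    · simp [st, Stacks.get, Stacks.set]
    · simp only [st, Stacks.get, List.length_replicate]
      have : T ^ (3 + 1) = T ^ 4 := rfl
      omega
  · intro j hj
    have hj' : j < k := by simpa using hj
    refine ⟨num (k - (j + 1)), ?_, ?_⟩
    · have : k - j = k - (j + 1) + 1 := by omega
      simp only [List.getElem_replicate, st, Stacks.get]
      rw [this]
      rfl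
    · simp only [List.getElem_replicate]
      refine ((R.push .kd sT _).seq ((inner j hj' (varEdges n j ++ E)).seq
        (R.move (w := .nd) (v := .n) (by decide) _))).cast ?_ ?_
      · simp [st, Stacks.get, Stacks.set, varEdges, accum, g]
      · simp only [Stacks.get, List.length_replicate]
        omega
  · simp [st, Stacks.get]

end Var

end StackProgram

namespace StackProgram

open Cmd

/-! ### The path -/

/-- The vertices of the path: separators between clauses, vertices between literals, and literals
of the variable with offset `v`. -/
inductive PathVert
  | sep
  | mid
  | lit (v : ℕ)

/-- The edges between the path vertex with number `i` and the variables and terminals. -/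
def attachEdges (i : ℕ) : PathVert → List (ℕ × ℕ)
  | .sep => [(i, 0), (i, 1), (i, 2), (i, 3)]
  | .mid => [(i, 0), (i, 1)]
  | .lit v => [(i, 4 + v), (i, 5 + v)]

/-- The edges of all path vertices, the last of which comes first in the list, together with edges
from each of them to the next one. The first of them has number `b`. -/
def pathEdges (b : ℕ) : List PathVert → List (ℕ × ℕ)
  | [] => []
  | p :: P => attachEdges (b + P.length) p ++
      (b + P.length, b + P.length + 1) :: pathEdges b P

/-- The current vertex of the path. -/
def idx : Ref := ([.m, .pc], 0)

/-- Descriptions of the edges of the current vertex of the path; for a literal, the offset of the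
variable is on the stack `y`. -/
def attachRefs : PathVert → List (Ref × Ref)
  | .sep => [(idx, ([], 0)), (idx, ([], 1)), (idx, ([], 2)), (idx, ([], 3))]
  | .mid => [(idx, ([], 0)), (idx, ([], 1))]
  | .lit _ => [(idx, ([.y], 4)), (idx, ([.y], 5))]

/-- Write a vertex of the path and the edge to the next one. -/
def writeVert (p : PathVert) : Cmd Stk Sym :=
  emitEdges (attachRefs p ++ [(idx, ([.m, .pc], 1))]) ;; .push .pc sT

/-- The program for one literal. -/
def litBody (g : Sym) : Cmd Stk Sym :=
  .push .rowr g ;; (if g = sT then writeVert .mid ;; writeVert (.lit 0) else .skip) ;;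
    pushN .y sT 4

/-- The program for one set of the family. -/
def rowBody : Cmd Stk Sym :=
  .whl .fam (fun g => decide (g ≠ sH)) (.push .row) ;; writeVert .sep ;;
    drain .k (fun g => .push .kd g ;; drain .row litBody ;; move .rowr .row) ;;
    move .kd .k ;; clear .row ;; clear .y

/-- The path vertices for the literals of one element in one row of the selection. -/
def litVerts (r : List Bool) (v u : ℕ) : List PathVert :=
  if r[u]? = some true then [.lit (v + 4 * u), .mid] else []

/-- The path vertices for one set of the family. -/
def rowVerts (n k : ℕ) (r : List Bool) : List PathVert :=
  accum (fun j => accum (litVerts r (4 * (n * j))) n) k ++ [.sep]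

/-- The path vertices for the first `i` sets of the family. -/
def famVerts (n k : ℕ) (rs : List (List Bool)) (i : ℕ) : List PathVert :=
  accum (fun i => rowVerts n k (rs.getD i [])) i

/-- The family on the stack `fam`. -/
def famSyms (rs : List (List Bool)) : List Sym :=
  rs.flatMap fun r => sH :: (r.map bit).reverse

theorem length_litVerts_le (r : List Bool) (v u : ℕ) : (litVerts r v u).length ≤ 2 := by
  unfold litVerts
  split <;> simp

theorem length_litsVerts_le (n k : ℕ) (r : List Bool) :
    (accum (fun j => accum (litVerts r (4 * (n * j))) n) k).length ≤ k * (n * 2) :=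
  length_accum_le (fun _ => length_accum_le (length_litVerts_le r _) n) k

theorem length_famVerts_le (n k : ℕ) (rs : List (List Bool)) (i : ℕ) :
    (famVerts n k rs i).length ≤ i * (k * (n * 2) + 1) :=
  length_accum_le (fun i => by
    have := length_litsVerts_le n k (rs.getD i [])
    simp only [rowVerts, List.length_append, List.length_singleton]
    omega) i

variable {T : ℕ}

/-- The offset of a literal is taken from the height of `y`, not from the argument of `lit`; `hp`
says that the two agree. -/
theorem attach_spec (p : PathVert) {s : Stacks} {v b i : ℕ}
    (hy : s.get .y = num v) (hm : s.get .m = num b) (hpc : s.get .pc = num i)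
    (hv : v ≤ T) (hb : b ≤ T) (hi : i ≤ T) (hp : ∀ w, p = .lit w → v = w) :
    (∀ e ∈ attachRefs p ++ [(idx, ([.m, .pc], 1))], e.1.Small s T ∧ e.2.Small s T) ∧
    (attachRefs p).map (fun e => (e.1.val s, e.2.val s)) = attachEdges (b + i) p := by
  cases p <;>
    simp [attachRefs, idx, Ref.Small, Ref.val, hy, hm, hpc, hb, hi, hv, attachEdges]
  exact hp _ rfl

theorem writeVert_spec (hT : 1 ≤ T) (p : PathVert) {s : Stacks} {v b : ℕ}
    {P : List PathVert} {E : List (ℕ × ℕ)}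
    (hy : s.get .y = num v) (hm : s.get .m = num b) (hpc : s.get .pc = num P.length)
    (ht : s.get .tmp = []) (hE : s.get .out = encodeEdges (pathEdges b P ++ E))
    (hv : v ≤ T) (hb : b ≤ T) (hP : P.length ≤ T) (hp : ∀ w, p = .lit w → v = w) :
    R (writeVert p) s ((s.set .out (encodeEdges (pathEdges b (p :: P) ++ E))).set .pc
      (num (p :: P).length)) (251 * T) := by
  obtain ⟨h1, h2⟩ := attach_spec p hy hm hpc hv hb hP hp
  have hlen : (attachRefs p).length ≤ 4 := by cases p <;> simp [attachRefs]
  refine ((R.emitEdges _ ht hE h1 hT).seq (R.push .pc sT _)).cast ?_ ?_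
  · rw [List.map_append, h2, Stacks.get_set_of_ne _ (by decide), hpc]
    simp [pathEdges, idx, Ref.val, hm, hpc, add_comm]
    rfl
  · simp only [List.length_append, List.length_singleton]
    have := Nat.mul_le_mul_right (50 * T) (Nat.succ_le_succ hlen)
    have h5 : (4 + 1) * (50 * T) = 250 * T := by ring
    simp only [Nat.succ_eq_add_one, h5] at this
    omega

/-- The stacks while the path is written. -/
def pathState (n k kd fam row rowr y : List Sym) (b : ℕ) (P : List PathVert) (E : List (ℕ × ℕ)) :
    Stacks :=
  { n := n, k := k, kd := kd, fam := fam, row := row, rowr := rowr, y := y, m := num b,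
    pc := num P.length, out := encodeEdges (pathEdges b P ++ E) }

theorem writeVert_pathState (hT : 1 ≤ T) (p : PathVert) {n k kd fam row rowr : List Sym}
    {v b : ℕ} {P : List PathVert} {E : List (ℕ × ℕ)} (hv : v ≤ T) (hb : b ≤ T)
    (hP : P.length ≤ T) (hp : ∀ w, p = .lit w → v = w) :
    R (writeVert p) (pathState n k kd fam row rowr (num v) b P E)
      (pathState n k kd fam row rowr (num v) b (p :: P) E) (251 * T) :=
  writeVert_spec hT p (v := v) rfl rfl rfl rfl rfl hv hb hP hp

theorem litBody_spec (hT : 1 ≤ T) {n k kd fam row rowr : List Sym} {r : List Bool} {v u b : ℕ}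
    {P : List PathVert} {E : List (ℕ × ℕ)} (hu : u < r.length) (hv : v + 4 * u ≤ T) (hb : b ≤ T)
    (hP : P.length + 2 ≤ T) :
    R (litBody (bit r[u])) (pathState n k kd fam row rowr (num (v + 4 * u)) b P E)
      (pathState n k kd fam row (bit r[u] :: rowr) (num (v + 4 * (u + 1))) b
        (litVerts r v u ++ P) E) (507 * T) := by
  have h1 := R.push .rowr (bit r[u]) (pathState n k kd fam row rowr (num (v + 4 * u)) b P E)
  have h2 : R (if bit r[u] = sT then writeVert .mid ;; writeVert (.lit 0) else .skip)
      (pathState n k kd fam row (bit r[u] :: rowr) (num (v + 4 * u)) b P E)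
      (pathState n k kd fam row (bit r[u] :: rowr) (num (v + 4 * u)) b (litVerts r v u ++ P) E)
      (502 * T) := by
    cases h : r[u]
    · rw [if_neg (by simp)]
      refine (R.skip _).cast ?_ (by simp)
      simp [litVerts, List.getElem?_eq_getElem hu, h]
    · rw [if_pos rfl]
      -- The program contains `.lit 0`, but `attachRefs` ignores the argument, so the same program
      -- writes the literal with any offset.
      refine ((writeVert_pathState hT .mid hv hb (by omega) (by simp)).seq
        (writeVert_pathState hT (.lit (v + 4 * u)) hv hb (by simp; omega) (by simp))).cast ?_ ?_
      · simp [litVerts, List.getElem?_eq_getElem hu, h]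
      · omega
  exact (h1.seq (h2.seq (R.pushN .y sT 4 _))).mono (by omega)

theorem rowLoop_spec (hT : 1 ≤ T) {n k kd fam : List Sym} {r : List Bool} {v b : ℕ}
    {P : List PathVert} {E : List (ℕ × ℕ)} (hr : r.length ≤ T) (hv : v + 4 * r.length ≤ T)
    (hb : b ≤ T) (hP : P.length + r.length * 2 ≤ T) :
    R (drain .row litBody ;; move .rowr .row)
      (pathState n k kd fam (r.map bit) [] (num v) b P E)
      (pathState n k kd fam (r.map bit) [] (num (v + 4 * r.length)) b
        (accum (litVerts r v) r.length ++ P) E) (512 * T ^ 2) := by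
  let st : ℕ → Stacks := fun u => pathState n k kd fam ((r.map bit).drop u)
    ((r.map bit).take u).reverse (num (v + 4 * u)) b (accum (litVerts r v) u ++ P) E
  have h := R.drain (w := .row) (b := 507 * T) (f := litBody) (r.map bit) st ?_ ?_
  · rw [List.length_map] at h
    refine ((h.mono (loop_time (c := 508) (d := 1) hT hr (by rw [pow_one]; omega))).seq
      (R.move (w := .rowr) (v := .row) (by decide) _)).cast ?_ ?_
    · have h1 : (r.map bit).drop r.length = [] := by simp
      have h2 : (r.map bit).take r.length = r.map bit := by simp
      simp only [st, pathState, h1, h2, Stacks.get, Stacks.set, List.reverse_reverse,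
        List.append_nil]
    · have : T ≤ T ^ 2 := Nat.le_self_pow (by norm_num) T
      simp [st, pathState, Stacks.get]
      omega
  · intro u hu
    have hu' : u < r.length := by simpa using hu
    refine ⟨(r.map bit).drop (u + 1), List.drop_eq_getElem_cons hu, ?_⟩
    rw [List.getElem_map]
    have hl := length_accum_le (length_litVerts_le r v) u
    refine (litBody_spec hT (r := r) (v := v) (P := accum (litVerts r v) u ++ P) hu' (by omega) hb
      (by rw [List.length_append]; omega)).cast ?_ le_rfl
    have h1 : ((r.map bit).take (u + 1)).reverse = bit r[u] :: ((r.map bit).take u).reverse := by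
      rw [List.take_succ_eq_append_getElem hu]
      simp
    simp only [st, h1, accum, List.append_assoc]
    rfl
  · simp [st, pathState, Stacks.get]

theorem rowBody_spec (hT : 1 ≤ T) {n k b : ℕ} {r : List Bool} {rs : List (List Bool)}
    {P : List PathVert} {E : List (ℕ × ℕ)} (hr : r.length = n) (hn : n ≤ T) (hk : k ≤ T)
    (hb : b ≤ T) (hnk : 4 * (n * k) ≤ T) (hP : P.length + (k * (n * 2) + 1) ≤ T) :
    R rowBody
      (pathState (num n) (num k) [] ((r.map bit).reverse ++ famSyms rs) [] [] [] b P E)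
      (pathState (num n) (num k) [] (famSyms rs) [] [] [] b (rowVerts n k r ++ P) E)
      (800 * T ^ 3) := by
  -- The family is stored with its rows reversed; popping a row up to the next `#` and pushing it on
  -- `row` restores the order.
  have h1 := R.whl_push (w := .fam) (v := .row) (by decide) (fun g => decide (g ≠ sH)) id
    (l := (r.map bit).reverse) (r := famSyms rs) (fun g hg => by
      obtain ⟨c, -, rfl⟩ := List.mem_map.1 (List.mem_reverse.1 hg)
      rfl) (by cases rs <;> simp [famSyms])
    (pathState (num n) (num k) [] ((r.map bit).reverse ++ famSyms rs) [] [] [] b P E) rfl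
  rw [List.map_id, List.reverse_reverse] at h1
  have h2 := writeVert_pathState hT .sep (n := num n) (k := num k) (kd := []) (fam := famSyms rs)
    (row := r.map bit) (rowr := []) (v := 0) (b := b) (P := P) (E := E) (by omega) hb (by omega)
    (by simp)
  -- The path after `j` rows of the selection have been treated: their literals in front of the
  -- separator that opens the clause.
  let Q : ℕ → List PathVert := fun j => accum (fun j => accum (litVerts r (4 * (n * j))) n) j ++
    .sep :: P
  let st : ℕ → Stacks := fun j => pathState (num n) (num (k - j)) (num j) (famSyms rs)
    (r.map bit) [] (num (4 * (n * j))) b (Q j) E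
  have h3 := R.drain (w := .k) (b := 1 + 512 * T ^ 2)
    (f := fun g => .push .kd g ;; drain .row litBody ;; move .rowr .row) (num k) st ?_ ?_
  · rw [List.length_replicate] at h3
    have h1' := h1.cast (s'' := pathState (num n) (num k) [] (famSyms rs) (r.map bit) [] [] b P E)
      (by simp [pathState, Stacks.get, Stacks.set]) le_rfl
    refine (h1'.seq (h2.seq ((h3.mono (loop_time (c := 514) (d := 2) hT hk ?_)).seq
      ((R.move (w := .kd) (v := .k) (by decide) _).seq
      ((R.clear .row _).seq (R.clear .y _)))))).cast ?_ ?_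
    · have : 1 ≤ T ^ 2 := Nat.one_le_pow _ _ hT
      omega
    · simp [st, pathState, Stacks.get, Stacks.set, Q, rowVerts]
    · have hT3 : T ≤ T ^ 3 := Nat.le_self_pow (by norm_num) T
      have : T ^ (2 + 1) = T ^ 3 := rfl
      simp only [st, pathState, Stacks.get, Stacks.set, List.length_replicate, List.length_reverse,
        List.length_map]
      omega
  · intro j hj
    have hj' : j < k := by simpa using hj
    have h5 : n * (j + 1) ≤ n * k := Nat.mul_le_mul le_rfl hj'
    have h6 := length_litsVerts_le n j r
    have h7 : (j + 1) * (n * 2) ≤ k * (n * 2) := Nat.mul_le_mul_right _ hj'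
    rw [mul_add] at h5
    rw [add_mul] at h7
    refine ⟨num (k - (j + 1)), ?_, ?_⟩
    · have : k - j = k - (j + 1) + 1 := by omega
      simp only [List.getElem_replicate, st, pathState, Stacks.get]
      rw [this]
      rfl
    · rw [List.getElem_replicate]
      refine ((R.push .kd sT _).seq (rowLoop_spec hT (n := num n) (k := num (k - (j + 1)))
        (kd := num (j + 1)) (fam := famSyms rs) (r := r) (v := 4 * (n * j)) (P := Q j) (E := E)
        (by omega) (by rw [hr]; omega) hb ?_)).cast ?_ le_rfl
      · simp only [Q, List.length_append, List.length_cons]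
        omega
      · simp only [st, hr, Q, accum, List.append_assoc, mul_add, mul_one]
  · simp [st, pathState, Stacks.get]

/-! ### The whole graph -/

/-- The number of vertices outside the path. -/
def base (n k : ℕ) : ℕ := 4 * (n * k) + 4

/-- The vertices of the path except for the last one, in reverse order. -/
abbrev allVerts (n k : ℕ) (rs : List (List Bool)) : List PathVert := famVerts n k rs rs.length

/-- The edges of the graph. -/
def graphEdges (n k : ℕ) (rs : List (List Bool)) : List (ℕ × ℕ) :=
  attachEdges (base n k + (allVerts n k rs).length) .sep ++
    (pathEdges (base n k) (allVerts n k rs) ++ (varEdges n k ++ [(0, 1), (2, 3)]))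

/-- The code of the instance: the graph with its first `base n k` vertices, which is also the
parameter. -/
def graphSyms (n k : ℕ) (rs : List (List Bool)) : List Sym :=
  List.replicate (base n k) sP ++ (num (base n k) ++
    (List.replicate ((allVerts n k rs).length + 1) (bit false) ++
      sH :: encodeEdges (graphEdges n k rs)))

/-- The program which completes the code once all edges but those of the last vertex are
written. -/
def finish : Cmd Stk Sym :=
  emitEdges (attachRefs .sep) ;; .push .pc sT ;; .push .out sH ;;
    drain .pc (fun _ => .push .out (bit false)) ;; copy .m .out ;;
    drain .m (fun _ => .push .out sP) ;; clear .n ;; clear .k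

/-- The program which writes the graph. -/
def build : Cmd Stk Sym :=
  emitEdges [(([], 0), ([], 1)), (([], 2), ([], 3))] ;; varLoop ;;
    (move .y .m ;; pushN .m sT 4) ;; drain .fam (fun _ => rowBody) ;; finish

/-- The last separator gets no edge to a successor. As the output grows at its front, the
characteristic vector is written after the edges, with the zeros of the path before the ones of the
modulator, and the separators for the parameter come last. -/
theorem finish_spec (hT : 1 ≤ T) {n k b : ℕ} {P : List PathVert} {E : List (ℕ × ℕ)}
    (hn : n ≤ T) (hk : k ≤ T) (hb : b ≤ T) (hP : P.length ≤ T) :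
    R finish (pathState (num n) (num k) [] [] [] [] [] b P E)
      { out := List.replicate b sP ++ (num b ++ (List.replicate (P.length + 1) (bit false) ++
          sH :: encodeEdges (attachEdges (b + P.length) .sep ++ (pathEdges b P ++ E)))) }
      (300 * T) := by
  obtain ⟨h1, h2⟩ := attach_spec .sep
    (s := pathState (num n) (num k) [] [] [] [] [] b P E) (v := 0) rfl rfl rfl (by omega) hb hP
    (by simp)
  have h3 := R.emitEdges (attachRefs .sep) (E := pathEdges b P ++ E) rfl rfl
    (fun e he => h1 e (List.mem_append_left _ he)) hT
  rw [h2] at h3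
  refine (h3.seq ((R.push .pc sT _).seq ((R.push .out sH _).seq
    ((R.drain_push (w := .pc) (v := .out) (by decide) (fun _ => bit false) _).seq
    ((R.copy (w := .m) (o := .out) (by decide) (by decide) (by decide) _ rfl).seq
    ((R.drain_push (w := .m) (v := .out) (by decide) (fun _ => sP) _).seq
    ((R.clear .n _).seq (R.clear .k _)))))))).cast ?_ ?_
  · simp [pathState, Stacks.get, Stacks.set, ← List.replicate_succ]
  · simp [pathState, Stacks.get, Stacks.set, attachRefs]
    omega

theorem build_spec (hT : 1 ≤ T) {n k : ℕ} {rs : List (List Bool)} (hr : ∀ r ∈ rs, r.length = n)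
    (hn : n ≤ T) (hk : k ≤ T) (hrs : rs.length ≤ T) (hb : base n k ≤ T)
    (hP : rs.length * (k * (n * 2) + 1) ≤ T) :
    R build { n := num n, k := num k, fam := famSyms rs } { out := graphSyms n k rs }
      (2000 * T ^ 4) := by
  have h1 : R (emitEdges [(([], 0), ([], 1)), (([], 2), ([], 3))])
      { n := num n, k := num k, fam := famSyms rs }
      { n := num n, k := num k, fam := famSyms rs, out := encodeEdges [(0, 1), (2, 3)] }
      (100 * T) := by
    refine (R.emitEdges _ (E := []) rfl rfl (T := T) (by simp [Ref.Small]) hT).cast ?_ ?_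
    · simp [Ref.val, Stacks.set]
    · simp
      omega
  have h2 := varLoop_spec hT (fam := famSyms rs) (E := [(0, 1), (2, 3)]) hn hk
    (by unfold base at hb; omega)
  let E := varEdges n k ++ [(0, 1), (2, 3)]
  have h3 : R (move .y .m ;; pushN .m sT 4)
      { n := num n, k := num k, fam := famSyms rs, y := num (4 * (n * k)),
        out := encodeEdges (varEdges n k ++ [(0, 1), (2, 3)]) }
      (pathState (num n) (num k) [] (famSyms rs) [] [] [] (base n k) [] E) (2 * T + 5) := by
    refine ((R.move (w := .y) (v := .m) (by decide) _).seq (R.pushN .m sT 4 _)).cast ?_ ?_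
    · simp [pathState, Stacks.get, Stacks.set, base, pathEdges, E]
      rfl
    · simp only [Stacks.get, List.length_replicate]
      unfold base at hb
      omega
  let st : ℕ → Stacks := fun i => pathState (num n) (num k) [] (famSyms (rs.drop i)) [] [] []
    (base n k) (famVerts n k rs i) E
  -- The outer loop itself only pops the `#` in front of each row; the bits are consumed by
  -- `rowBody`. Hence its list of consumed symbols consists of `rs.length` copies of `#`.
  have h4 := R.drain (w := .fam) (b := 800 * T ^ 3) (f := fun _ => rowBody)
    (List.replicate rs.length sH) st ?_ ?_
  · rw [List.length_replicate] at h4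
    have h5 : st rs.length = pathState (num n) (num k) [] [] [] [] [] (base n k)
        (allVerts n k rs) E := by
      simp [st, famSyms]
    rw [h5] at h4
    have hl := length_famVerts_le n k rs rs.length
    have hT3 : 1 ≤ T ^ 3 := Nat.one_le_pow _ _ hT
    have hT4 : T ≤ T ^ 4 := Nat.le_self_pow (by norm_num) T
    have h4' := h4.mono (loop_time (c := 801) (d := 3) hT hrs (by omega))
    refine (h1.seq (h2.seq (h3.seq (h4'.seq (finish_spec hT hn hk hb (hl.trans hP)))))).mono ?_
    have : T ^ (3 + 1) = T ^ 4 := rfl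
    omega
  · intro i hi
    have hi' : i < rs.length := by simpa using hi
    refine ⟨(rs[i].map bit).reverse ++ famSyms (rs.drop (i + 1)), ?_, ?_⟩
    · simp only [List.getElem_replicate, st, pathState, Stacks.get]
      rw [List.drop_eq_getElem_cons hi']
      rfl
    · have hl := length_famVerts_le n k rs i
      have h5 : (i + 1) * (k * (n * 2) + 1) ≤ rs.length * (k * (n * 2) + 1) :=
        Nat.mul_le_mul_right _ hi'
      rw [Nat.succ_mul] at h5
      refine (rowBody_spec hT (r := rs[i]) (rs := rs.drop (i + 1)) (P := famVerts n k rs i) (E := E)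
        (hr _ (List.getElem_mem hi')) hn hk hb (by unfold base at hb; omega) (by omega)).cast ?_
        le_rfl
      simp [st, famVerts, accum, List.getElem?_eq_getElem hi']
  · simp [st, pathState, Stacks.get, famSyms]

end StackProgram

namespace StackProgram

open Cmd

/-! ### Reading the input -/

namespace R

variable {s s' s'' : Stacks} {a b : ℕ} {w : Stk} {p : Sym → Bool} {f : Sym → Cmd Stk Sym}

theorem whl_nil (h : (s.get w).head?.any p = false) : R (.whl w p f) s s 1 :=
  ⟨1, le_rfl, .whl_done h⟩

theorem whl_cons {g : Sym} {r : List Sym} (hs : s.get w = g :: r) (hg : p g = true)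
    (h : R (f g) (s.set w r) s' a) (h' : R (.whl w p f) s' s'' b) :
    R (.whl w p f) s s'' (1 + a + b) := by
  obtain ⟨t, ht, hr⟩ := h
  obtain ⟨t', ht', hr'⟩ := h'
  rw [Stacks.get_set] at hr
  exact ⟨1 + t + t', by omega, .whl_step hs hg hr hr'⟩

end R

/-- Run one of two programs, according to whether there is something to pop from the stack `w`. -/
def popElse (w : Stk) (c d : Cmd Stk Sym) : Cmd Stk Sym := .case w fun o => o.elim d fun _ => c

theorem R.popElse_nil {w : Stk} {c d : Cmd Stk Sym} {s s' : Stacks} {b : ℕ} (hs : s.get w = [])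
    (h : R d s s' b) : R (popElse w c d) s s' (1 + b) := by
  refine R.case hs ?_
  have : s.set w [] = s := by rw [← hs, Stacks.set_get]
  simpa [this] using h

theorem R.popElse_cons {w : Stk} {c d : Cmd Stk Sym} {s s' : Stacks} {b : ℕ} {g : Sym}
    {r : List Sym} (hs : s.get w = g :: r) (h : R c (s.set w r) s' b) :
    R (popElse w c d) s s' (1 + b) := R.case hs h

/-- The code of an input of Hitting Set which is given by the size of the ground set, the bound on
the size of the hitting set, and the characteristic vectors. -/
def inputSyms (n k : ℕ) (rows : List (List Bool)) : List Sym :=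
  List.replicate n sP ++ (num n ++ sH :: (num k ++ sH :: rows.flatMap fun r => r.map bit ++ [sH]))

/-- `l` describes an input of Hitting Set. -/
def WellFormed (l : List Sym) : Prop :=
  ∃ n k rows, (∀ r ∈ rows, r.length = n) ∧ l = inputSyms n k rows

/-- `l` is the rest of a list of words of length `N` after the first `d` symbols of a word. -/
def RowsOK (N : ℕ) : ℕ → List Sym → Prop
  | d, [] => d = 0
  | _, none :: _ => False
  | d, some none :: l => d = N ∧ RowsOK N 0 l
  | d, some (some _) :: l => d < N ∧ RowsOK N (d + 1) l

theorem rowsOK_append {N d : ℕ} {r : List Bool} (l : List Sym) (h : d + r.length = N) :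
    RowsOK N d (r.map bit ++ sH :: l) ↔ RowsOK N 0 l := by
  induction r generalizing d with
  | nil => simp_all [RowsOK]
  | cons c r ih =>
    rw [List.length_cons] at h
    rw [List.map_cons, List.cons_append, RowsOK, ih (by omega)]
    exact and_iff_right (by omega)

theorem RowsOK.exists_rows {N d : ℕ} {l : List Sym} (h : RowsOK N d l) (hd : d ≤ N) :
    (d = 0 ∧ l = []) ∨ ∃ (r : List Bool) (rows : List (List Bool)), d + r.length = N ∧
      (∀ r ∈ rows, r.length = N) ∧
      l = r.map bit ++ sH :: rows.flatMap fun r => r.map bit ++ [sH] := by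
  induction l generalizing d with
  | nil => exact .inl ⟨h, rfl⟩
  | cons g l ih =>
    right
    rcases g with _ | _ | c
    · exact h.elim
    · obtain ⟨rfl, h⟩ := h
      rcases ih h (Nat.zero_le _) with ⟨-, rfl⟩ | ⟨r, rows, h1, h2, rfl⟩
      · exact ⟨[], [], rfl, by simp, rfl⟩
      · exact ⟨[], r :: rows, rfl, by simpa using ⟨by omega, h2⟩, by simp⟩
    · obtain ⟨hdN, h⟩ := h
      rcases ih h hdN with ⟨h, -⟩ | ⟨r, rows, h1, h2, rfl⟩
      · omega
      · exact ⟨c :: r, rows, by simp; omega, h2, rfl⟩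

/-- Replaces the existence of a division into rows by a condition that one pass with a counter can
test. -/
theorem rowsOK_iff {N : ℕ} {l : List Sym} : RowsOK N 0 l ↔ ∃ rows : List (List Bool),
    (∀ r ∈ rows, r.length = N) ∧ l = rows.flatMap fun r => r.map bit ++ [sH] := by
  constructor
  · intro h
    rcases h.exists_rows (Nat.zero_le _) with ⟨-, rfl⟩ | ⟨r, rows, h1, h2, rfl⟩
    · exact ⟨[], by simp, rfl⟩
    · exact ⟨r :: rows, by simpa using ⟨by omega, h2⟩, by simp⟩
  · rintro ⟨rows, h, rfl⟩
    induction rows with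
    | nil => rfl
    | cons r rows ih =>
      rw [List.flatMap_cons, List.append_assoc, List.singleton_append,
        rowsOK_append _ (by simpa using h r (by simp))]
      exact ih fun r hr => h r (by simp [hr])

/-- Splitting off maximal runs is possible for every word, so the parser can be analysed on
malformed inputs too. By `replicate_append_inj` the splitting is unique, and on a well-formed word
it yields the intended fields. -/
theorem exists_replicate_append (g : Sym) (l : List Sym) :
    ∃ p r, l = List.replicate p g ++ r ∧ r.head? ≠ some g := by
  induction l with
  | nil => exact ⟨0, [], rfl, by simp⟩
  | cons x l ih =>
    by_cases h : x = g
    · obtain ⟨p, r, rfl, hr⟩ := ih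
      exact ⟨p + 1, r, by simp [List.replicate_succ, h], hr⟩
    · exact ⟨0, x :: l, rfl, by simpa using h⟩

theorem replicate_append_inj {g : Sym} {p p' : ℕ} {r r' : List Sym}
    (h : List.replicate p g ++ r = List.replicate p' g ++ r') (hr : r.head? ≠ some g)
    (hr' : r'.head? ≠ some g) : p = p' ∧ r = r' := by
  induction p generalizing p' with
  | zero =>
    cases p' with
    | zero => exact ⟨rfl, h⟩
    | succ p' =>
      rw [List.replicate_zero, List.nil_append] at h
      subst h
      exact absurd (by simp [List.replicate_succ]) hr
  | succ p ih =>
    cases p' with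
    | zero =>
      rw [List.replicate_zero, List.nil_append] at h
      subst h
      exact absurd (by simp [List.replicate_succ]) hr'
    | succ p' =>
      simp only [List.replicate_succ, List.cons_append, List.cons.injEq, true_and] at h
      obtain ⟨rfl, rfl⟩ := ih h
      exact ⟨rfl, rfl⟩

/-- Report that the input is malformed. -/
def report : Cmd Stk Sym := .push .bad sT

/-- Read the end of a word. -/
def readEnd : Cmd Stk Sym := .case .inp fun o => if o = some sH then .skip else report

/-- Read a symbol of the family. -/
def readSym (g : Sym) : Cmd Stk Sym :=
  .push .fam g ;; match g with
    | none => report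
    | some none => popElse .n (.push .n sT ;; report) .skip ;; move .nd .n
    | some (some _) => popElse .n (.push .nd sT) report

/-- Read the size of the ground set, and compare it to the parameter. -/
def readSize : Cmd Stk Sym :=
  .whl .inp (fun g => decide (g = sP)) (.push .par) ;;
    .whl .inp (fun g => decide (g = sT))
      (fun _ => .push .n sT ;; .push .cap sT ;; popElse .par .skip report) ;;
    drain .par (fun _ => report)

/-- Read the input of Hitting Set. -/
def parse : Cmd Stk Sym :=
  move .raw .inp ;; readSize ;; readEnd ;;
    .whl .inp (fun g => decide (g = sT)) (fun _ => popElse .cap (.push .k sT) .skip) ;;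
    clear .cap ;; readEnd ;; drain .inp readSym ;; popElse .nd report .skip

variable {T : ℕ}

/-- The heights of `n` and `nd` count the bits that are still missing from the current row and those
already read. Their sum is invariant, even after an error: a premature `#` restores the full
counter, and a surplus bit only adds a report. -/
theorem readSym_loop {l : List Sym} {a d e : ℕ} {k f : List Sym} (hT : a + d ≤ T) :
    ∃ a' d' e', R (drain .inp readSym)
        { inp := l, n := num a, nd := num d, k := k, fam := f, bad := num e }
        { n := num a', nd := num d', k := k, fam := l.reverse ++ f, bad := num e' }
        (l.length * (2 * T + 10) + 1) ∧
      a' + d' = a + d ∧ e' ≤ e + l.length ∧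
      (e' = 0 ∧ d' = 0 ↔ e = 0 ∧ RowsOK (a + d) d l) := by
  induction l generalizing a d e f with
  | nil => exact ⟨a, d, e, R.whl_nil rfl |>.mono (by simp), rfl, by simp, by simp [RowsOK]⟩
  | cons g l ih =>
    have key : ∀ a1 d1 e1, R (readSym g)
        { inp := l, n := num a, nd := num d, k := k, fam := f, bad := num e }
        { inp := l, n := num a1, nd := num d1, k := k, fam := g :: f, bad := num e1 }
        (2 * T + 9) → a1 + d1 = a + d → e1 ≤ e + 1 →
        (e1 = 0 ∧ RowsOK (a + d) d1 l ↔ e = 0 ∧ RowsOK (a + d) d (g :: l)) →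
        ∃ a' d' e', R (drain .inp readSym)
            { inp := g :: l, n := num a, nd := num d, k := k, fam := f, bad := num e }
            { n := num a', nd := num d', k := k, fam := (g :: l).reverse ++ f, bad := num e' }
            ((g :: l).length * (2 * T + 10) + 1) ∧
          a' + d' = a + d ∧ e' ≤ e + (g :: l).length ∧
          (e' = 0 ∧ d' = 0 ↔ e = 0 ∧ RowsOK (a + d) d (g :: l)) := by
      intro a1 d1 e1 h1 h2 h3 h4
      obtain ⟨a', d', e', h5, h6, h7, h8⟩ := ih (a := a1) (d := d1) (e := e1) (f := g :: f)
        (h2 ▸ hT)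
      refine ⟨a', d', e', ?_, h6.trans h2, ?_, ?_⟩
      · refine (R.whl_cons (w := .inp) rfl rfl h1 h5).cast ?_ ?_
        · simp
        · simp only [List.length_cons, Nat.add_mul]
          omega
      · simp only [List.length_cons]
        omega
      · rw [h8, h2, h4]
    have h0 := R.push .fam g
      { inp := l, n := num a, nd := num d, k := k, fam := f, bad := num e }
    rcases g with _ | _ | c
    · exact key a d (e + 1) ((h0.seq (R.push .bad sT _)).mono (by omega)) rfl le_rfl
        (by simp [RowsOK])
    · have hmove := fun e => R.move (w := .nd) (v := .n) (by decide)
        { inp := l, n := num a, nd := num d, k := k, fam := sH :: f, bad := num e }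
      simp only [Stacks.get, Stacks.set, List.reverse_replicate, List.length_replicate,
        List.replicate_append_replicate] at hmove
      cases a with
      | zero =>
        refine key (d + 0) 0 e ((h0.seq ((R.popElse_nil rfl (R.skip _)).seq (hmove e))).mono
          (by omega)) (by omega) (by omega) ?_
        simp [RowsOK]
      | succ a =>
        refine key (d + (a + 1)) 0 (e + 1) ((h0.seq ((R.popElse_cons (r := num a) rfl
          ((R.push .n sT _).seq (R.push .bad sT _))).seq (hmove (e + 1)))).mono
          (by omega)) (by omega) (by omega) ?_
        simp [RowsOK]
    · cases a with
      | zero =>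
        refine key 0 d (e + 1) ((h0.seq (R.popElse_nil rfl (R.push .bad sT _))).mono
          (by omega)) (by omega) (by omega) ?_
        simp [RowsOK]
      | succ a =>
        refine key a (d + 1) e ((h0.seq (R.popElse_cons (r := num a) rfl
          (R.push .nd sT _))).mono (by omega)) (by omega) (by omega) ?_
        simp [RowsOK]

/-- Of the two truncated differences at most one is nonzero, so there is no report exactly when the
parameter equals the unary size. -/
theorem readSize_spec {p a : ℕ} {l : List Sym} (hl : l.head? ≠ some sT)
    (hl' : (num a ++ l).head? ≠ some sP) :
    R readSize { inp := List.replicate p sP ++ (num a ++ l) }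
      { inp := l, n := num a, cap := num a, bad := num ((a - p) + (p - a)) }
      (10 * (p + a) + 10) := by
  have h1 := R.whl_push (w := .inp) (v := .par) (by decide) (fun g => decide (g = sP)) id
    (l := List.replicate p sP) (r := num a ++ l) (by simp) (by
      cases h : (num a ++ l).head? <;> simp_all)
    { inp := List.replicate p sP ++ (num a ++ l) } rfl
  let st : ℕ → Stacks := fun i =>
    { inp := num (a - i) ++ l, par := List.replicate (p - i) sP, n := num i, cap := num i,
      bad := num (i - p) }
  have h2 := R.whl (w := .inp) (b := 5) (p := fun g => decide (g = sT))
    (f := fun _ => .push .n sT ;; .push .cap sT ;; popElse .par .skip report) (num a) st ?_ ?_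
  · rw [List.length_replicate] at h2
    have h3 := R.drain_push (w := .par) (v := .bad) (by decide) (fun _ => sT) (st a)
    have h1' := h1.cast (s'' := st 0) (by simp [st, Stacks.get, Stacks.set]) le_rfl
    refine (h1'.seq (h2.seq h3)).cast ?_ ?_
    · simp [st, Stacks.get, Stacks.set, add_comm]
    · simp [st, Stacks.get]
      omega
  · intro i hi
    have hi' : i < a := by simpa using hi
    refine ⟨num (a - (i + 1)) ++ l, ?_, by simp, ?_⟩
    · have : a - i = a - (i + 1) + 1 := by omega
      simp only [List.getElem_replicate, st, Stacks.get]
      rw [this]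
      rfl
    · refine ((R.push .n sT _).seq ((R.push .cap sT _).seq (b := 3) ?_)).mono le_rfl
      by_cases h : i < p
      · obtain ⟨x, hx⟩ : ∃ x, p - i = x + 1 := ⟨p - i - 1, by omega⟩
        refine (R.popElse_cons (g := sP) (r := List.replicate x sP) ?_ (R.skip _)).cast ?_
          (by omega)
        · simp only [st, Stacks.get, Stacks.set, hx]
          rfl
        · have h4 : p - (i + 1) = x := by omega
          have h5 : i - p = 0 := by omega
          have h6 : i + 1 - p = 0 := by omega
          simp only [st, Stacks.get, Stacks.set, h4, h5, h6]
          rfl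
      · have h4 : p - i = 0 := by omega
        have h5 : p - (i + 1) = 0 := by omega
        have h6 : i + 1 - p = i - p + 1 := by omega
        refine (R.popElse_nil ?_ (R.push .bad sT _)).cast ?_ (by omega)
        · simp [st, Stacks.get, Stacks.set, h4]
        · simp only [st, Stacks.get, Stacks.set, h4, h5, h6]
          rfl
  · cases h : l.head? <;> simp_all [st, Stacks.get]

theorem readEnd_spec {l n cap k : List Sym} {e : ℕ} : ∃ e', R readEnd
    { inp := l, n := n, cap := cap, k := k, bad := num e }
    { inp := l.tail, n := n, cap := cap, k := k, bad := num e' } 2 ∧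
    e' ≤ e + 1 ∧ (e' = 0 ↔ e = 0 ∧ l.head? = some sH) := by
  by_cases h : l.head? = some sH
  · refine ⟨e, (R.case (w := .inp) (l := l) (a := 0) rfl ?_).mono (by omega), by omega, by simp [h]⟩
    rw [if_pos h]
    exact R.skip _
  · refine ⟨e + 1, (R.case (w := .inp) (l := l) (a := 1) rfl ?_).mono (by omega), by omega, by simp [h]⟩
    rw [if_neg h]
    exact R.push .bad sT _

/-- The stack `cap` starts with height `a`; once it is exhausted, further ones are read without
effect. This caps the bound of the hitting set at the size of the ground set. -/
theorem readBound_spec {a c : ℕ} {n bad l : List Sym} (hl : l.head? ≠ some sT) :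
    R (.whl .inp (fun g => decide (g = sT)) fun _ => popElse .cap (.push .k sT) .skip)
      { inp := num c ++ l, n := n, cap := num a, bad := bad }
      { inp := l, n := n, cap := num (a - c), k := num (min a c), bad := bad } (3 * c + 1) := by
  let st : ℕ → Stacks := fun i =>
    { inp := num (c - i) ++ l, n := n, cap := num (a - i), k := num (min a i), bad := bad }
  have h2 := R.whl (w := .inp) (b := 2) (p := fun g => decide (g = sT))
    (f := fun _ => popElse .cap (.push .k sT) .skip) (num c) st ?_ ?_
  · rw [List.length_replicate] at h2
    have h0 : st 0 = { inp := num c ++ l, n := n, cap := num a, bad := bad } := by simp [st]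
    rw [h0] at h2
    refine h2.cast ?_ (by omega)
    simp [st]
  · intro i hi
    have hi' : i < c := by simpa using hi
    refine ⟨num (c - (i + 1)) ++ l, ?_, by simp, ?_⟩
    · have : c - i = c - (i + 1) + 1 := by omega
      simp only [List.getElem_replicate, st, Stacks.get]
      rw [this]
      rfl
    · by_cases h : i < a
      · obtain ⟨x, hx⟩ : ∃ x, a - i = x + 1 := ⟨a - i - 1, by omega⟩
        refine (R.popElse_cons (g := sT) (r := num x) ?_ (R.push .k sT _)).cast ?_ (by omega)
        · simp only [st, Stacks.get, Stacks.set, hx]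
          rfl
        · have h4 : a - (i + 1) = x := by omega
          have h5 : min a i = i := by omega
          have h6 : min a (i + 1) = i + 1 := by omega
          simp only [st, Stacks.get, Stacks.set, h4, h5, h6]
          rfl
      · have h4 : a - i = 0 := by omega
        have h5 : a - (i + 1) = 0 := by omega
        have h6 : min a (i + 1) = min a i := by omega
        refine (R.popElse_nil ?_ (R.skip _)).cast ?_ (by omega)
        · simp [st, Stacks.get, Stacks.set, h4]
        · simp only [st, Stacks.set, h4, h5, h6]
  · cases h : l.head? <;> simp_all [st, Stacks.get]

/-- Errors are counted rather than acted upon, so a single sequence of runs covers all inputs. The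
input is well formed exactly when no error is counted, and then the stacks hold its data, with the
rows in reverse order. -/
theorem parse_spec (l : List Sym) : ∃ a d e k f,
    R parse { raw := l.reverse } { n := num a, nd := num d, k := k, fam := f, bad := num e }
      (100 * (l.length + 1) ^ 2) ∧
    a ≤ l.length ∧ d ≤ l.length ∧ k.length ≤ l.length ∧ f.length ≤ l.length ∧
    e ≤ 3 * l.length + 3 ∧
    (e = 0 → ∃ c rows, (∀ r ∈ rows, r.length = a) ∧ l = inputSyms a c rows ∧ d = 0 ∧
      k = num (min a c) ∧ f = famSyms rows.reverse) ∧
    (WellFormed l → e = 0) := by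
  obtain ⟨p, l₁, hl, hl₁⟩ := exists_replicate_append sP l
  obtain ⟨a, l₂, rfl, hl₂⟩ := exists_replicate_append sT l₁
  obtain ⟨c, l₃, hl₃, hl₃'⟩ := exists_replicate_append sT l₂.tail
  have hlen : l.length = p + (a + l₂.length) := by rw [hl]; simp
  have hlen₂ : l₂.length - 1 = c + l₃.length := by
    rw [← List.length_tail, hl₃]; simp
  have hlen₃ : l₃.tail.length = l₃.length - 1 := List.length_tail
  have hlen₄ : l₃.tail.length ≤ l.length := by omega
  have h1 := R.move (w := .raw) (v := .inp) (by decide) { raw := l.reverse }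
  simp only [Stacks.get, Stacks.set, List.reverse_reverse, List.append_nil,
    List.length_reverse] at h1
  have h2 := readSize_spec (p := p) hl₂ hl₁
  rw [← hl] at h2
  obtain ⟨e₁, h3, he₁, he₁'⟩ := readEnd_spec (l := l₂) (n := num a) (cap := num a) (k := [])
    (e := (a - p) + (p - a))
  have h4 := readBound_spec (a := a) (c := c) (n := num a) (bad := num e₁) hl₃'
  rw [← hl₃] at h4
  have h5 := R.clear .cap
    { inp := l₃, n := num a, cap := num (a - c), k := num (min a c), bad := num e₁ }
  simp only [Stacks.get, Stacks.set, List.length_replicate] at h5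
  obtain ⟨e₂, h6, he₂, he₂'⟩ := readEnd_spec (l := l₃) (n := num a) (cap := [])
    (k := num (min a c)) (e := e₁)
  obtain ⟨a', d', e₃, h7, had, he₃, he₃'⟩ := readSym_loop (T := l.length) (l := l₃.tail) (a := a)
    (d := 0) (e := e₂) (k := num (min a c)) (f := []) (by omega)
  obtain ⟨d'', e₄, h8, hd'', he₄, he₄'⟩ : ∃ d'' e₄, R (popElse .nd report .skip)
      { n := num a', nd := num d', k := num (min a c), fam := l₃.tail.reverse ++ [], bad := num e₃ }
      { n := num a', nd := num d'', k := num (min a c), fam := l₃.tail.reverse ++ [],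
        bad := num e₄ } 2 ∧ d'' ≤ d' ∧ e₄ ≤ e₃ + 1 ∧ (e₄ = 0 ↔ e₃ = 0 ∧ d' = 0) := by
    cases d' with
    | zero => exact ⟨0, e₃, (R.popElse_nil rfl (R.skip _)).mono (by omega), by omega, by omega,
        by simp⟩
    | succ d => exact ⟨d, e₃ + 1, R.popElse_cons (r := num d) rfl (R.push .bad sT _), by omega,
        le_rfl, by simp⟩
  have hR : R parse { raw := l.reverse }
      { n := num a', nd := num d'', k := num (min a c), fam := l₃.tail.reverse ++ [],
        bad := num e₄ } (100 * (l.length + 1) ^ 2) := by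
    have h78 := h1.seq (h2.seq (h3.seq (h4.seq (h5.seq (h6.seq (h7.seq h8))))))
    refine h78.mono ?_
    clear h78 he₁' he₂' he₃' he₄' h1 h2 h3 h4 h5 h6 h7 h8
    have h9 : l₃.tail.length * (2 * l.length + 10) ≤ l.length * (2 * l.length + 10) :=
      Nat.mul_le_mul_right _ hlen₄
    have h10 : 100 * (l.length + 1) ^ 2 = l.length * (2 * l.length + 10) + 98 * (l.length ^ 2) +
        190 * l.length + 100 := by ring
    rw [h10]
    clear h10 hlen₃ hlen₄ had he₃ he₂ he₁ hd'' he₄ hl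
    generalize l₃.tail.length * (2 * l.length + 10) = X at *
    generalize l.length * (2 * l.length + 10) = Y at *
    generalize l.length ^ 2 = Z at *
    omega
  clear h1 h2 h3 h4 h5 h6 h7 h8
  have hbound : a' ≤ l.length ∧ d'' ≤ l.length ∧ e₄ ≤ 3 * l.length + 3 := by
    clear he₁' he₂' he₃' he₄' hR
    omega
  have heq : e₄ = 0 ↔ (a = p ∧ l₂.head? = some sH) ∧ l₃.head? = some sH ∧ RowsOK a 0 l₃.tail := by
    rw [he₄', he₃', he₂', he₁', add_zero]
    constructor
    · rintro ⟨⟨⟨h, g₁⟩, g₂⟩, g₃⟩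
      exact ⟨⟨by omega, g₁⟩, g₂, g₃⟩
    · rintro ⟨⟨h, g₁⟩, g₂, g₃⟩
      exact ⟨⟨⟨by omega, g₁⟩, g₂⟩, g₃⟩
  have hcons : ∀ {l : List Sym}, l.head? = some sH → l = sH :: l.tail := by
    intro l h
    cases l with
    | nil => cases h
    | cons x l => simp at h; simp [h]
  refine ⟨a', d'', e₄, num (min a c), l₃.tail.reverse ++ [],
    hR, hbound.1, hbound.2.1, ?_, ?_, hbound.2.2, ?_, ?_⟩
  · rw [List.length_replicate]
    omega
  · simp only [List.append_nil, List.length_reverse]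
    omega
  · intro h
    have hd' : d' = 0 := (he₄'.1 h).2
    obtain ⟨⟨rfl, g₁⟩, g₂, g₃⟩ := heq.1 h
    obtain ⟨rows, hr, hrows⟩ := rowsOK_iff.1 g₃
    have ha : a' = a := by omega
    refine ⟨c, rows, ha ▸ hr, ?_, by omega, by rw [ha], ?_⟩
    · rw [hl, hcons g₁, hl₃, hcons g₂, hrows, ha]
      rfl
    · rw [hrows, List.append_nil, famSyms, List.flatMap_reverse]
      simp [Function.comp_def]
  · rintro ⟨n, k, rows, hr, h⟩
    rw [heq]
    rw [hl] at h
    unfold inputSyms at h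
    -- Uniqueness of maximal runs identifies the three numbers found by the parser with the fields
    -- of the well-formed word.
    obtain ⟨rfl, g⟩ := replicate_append_inj h hl₁ (by cases n <;> simp [List.replicate_succ])
    obtain ⟨rfl, g'⟩ := replicate_append_inj g hl₂ (by simp)
    subst g'
    obtain ⟨rfl, g'⟩ := replicate_append_inj hl₃ (by simp) hl₃'
    subst g'
    exact ⟨⟨rfl, rfl⟩, rfl, rowsOK_iff.2 ⟨rows, hr, rfl⟩⟩

/-! ### The assembled reduction program -/

/-- The program which maps an input of Hitting Set to a graph. -/
def reduction : Cmd Stk Sym :=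
  parse ;; popElse .bad (clear .n ;; clear .nd ;; clear .k ;; clear .fam ;; clear .bad) build

theorem reduction_spec (l : List Sym) :
    (∃ n k rows, (∀ r ∈ rows, r.length = n) ∧ l = inputSyms n k rows ∧
      R reduction { raw := l.reverse } { out := graphSyms n (min n k) rows.reverse }
        (10 ^ 7 * (l.length + 1) ^ 12)) ∨
    (¬ WellFormed l ∧ R reduction { raw := l.reverse } {} (10 ^ 7 * (l.length + 1) ^ 12)) := by
  obtain ⟨a, d, e, k, f, h, ha, hd, hk, hf, he, h0, h1⟩ := parse_spec l
  have hpow : (l.length + 1) ^ 2 ≤ (l.length + 1) ^ 12 :=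
    Nat.pow_le_pow_right (by omega) (by norm_num)
  have hpow1 : l.length + 1 ≤ (l.length + 1) ^ 12 := Nat.le_self_pow (by norm_num) _
  cases e with
  | zero =>
    obtain ⟨c, rows, hr, hl, rfl, rfl, rfl⟩ := h0 rfl
    refine .inl ⟨a, c, rows, hr, hl, ?_⟩
    have hrows : rows.length ≤ l.length := by
      have : rows.length ≤ (rows.flatMap fun r => r.map bit ++ [sH]).length := by
        rw [List.length_flatMap]
        simp
      rw [hl]
      simp only [inputSyms, List.length_append, List.length_cons]
      omega
    have hm : min a c ≤ l.length := (min_le_left _ _).trans ha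
    generalize l.length = N at *
    have h2 : a * min a c ≤ N * N := Nat.mul_le_mul ha hm
    have h3 : rows.length * (min a c * (a * 2) + 1) ≤ N * (N * (N * 2) + 1) := by gcongr
    have h6 : 8 * (N + 1) ^ 3 = 8 * (N * (N * N)) + 24 * (N * N) + 24 * N + 8 := by ring
    have h7 : N * (N * (N * 2) + 1) = 2 * (N * (N * N)) + N := by ring
    -- `T` must dominate all heights, and the longest stack counts the path vertices, up to `2 * n *
    -- k + 1` per row, which is cubic in the input length. The fourth power of `T` then gives the
    -- exponent 12.
    have h4 := build_spec (T := 8 * (N + 1) ^ 3) (n := a) (k := min a c) (rs := rows.reverse)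
      (by omega) (fun r h => hr r (by simpa using h)) (by omega) (by omega)
      (by rw [List.length_reverse]; omega) (by unfold base; omega)
      (by rw [List.length_reverse]; omega)
    refine (h.seq (R.popElse_nil rfl h4)).mono ?_
    have h5 : 2000 * (8 * (N + 1) ^ 3) ^ 4 = 8192000 * (N + 1) ^ 12 := by ring
    omega
  | succ e =>
    refine .inr ⟨fun h => Nat.succ_ne_zero e (h1 h), ?_⟩
    refine (h.seq (R.popElse_cons (r := num e) rfl ((R.clear .n _).seq ((R.clear .nd _).seq
      ((R.clear .k _).seq ((R.clear .fam _).seq (R.clear .bad _))))))).mono ?_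
    simp only [Stacks.get, Stacks.set, List.length_replicate]
    omega

end StackProgram

/-! ### Combinatorics of the constructed graph -/

namespace StackProgram

/-! ### The shape of the path -/

theorem mem_accum {X : Type} {f : ℕ → List X} {i : ℕ} {x : X} :
    x ∈ accum f i ↔ ∃ j < i, x ∈ f j := by
  induction i with
  | zero => simp [accum]
  | succ i ih =>
    rw [accum, List.mem_append, ih, Nat.exists_lt_succ_right, or_comm]

theorem reverse_accum {X : Type} (f : ℕ → List X) (i : ℕ) :
    (accum f i).reverse = (List.range i).flatMap fun j => (f j).reverse := by
  induction i with
  | zero => rfl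
  | succ i ih => rw [accum, List.reverse_append, ih, List.range_succ, List.flatMap_append]; simp

theorem flatMap_range_getD {X : Type} (f : List Bool → List X) (rs : List (List Bool)) :
    ((List.range rs.length).flatMap fun i => f (rs.getD i [])) = rs.flatMap f := by
  induction rs with
  | nil => rfl
  | cons r rs ih =>
    rw [List.length_cons, List.range_succ_eq_map, List.flatMap_cons, List.flatMap_map,
      List.flatMap_cons, ← ih]
    simp

/-- The offsets of the variables in the clause for a characteristic vector. -/
def clauseVars (n k : ℕ) (r : List Bool) : List ℕ :=
  (List.range k).flatMap fun j => (List.range n).flatMap fun u =>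
    if r[u]? = some true then [4 * (n * j + u)] else []

theorem mem_clauseVars {n k v : ℕ} {r : List Bool} :
    v ∈ clauseVars n k r ↔ ∃ j < k, ∃ u < n, r[u]? = some true ∧ v = 4 * (n * j + u) := by
  simp only [clauseVars, List.mem_flatMap, List.mem_range]
  refine exists_congr fun j => and_congr_right fun _ => exists_congr fun u =>
    and_congr_right fun _ => ?_
  split_ifs with h <;> simp [h]

/-- The part of the path for a clause, without separators. -/
def clausePath (vs : List ℕ) : List PathVert := vs.flatMap fun v => [.mid, .lit v]

/-- The path for a list of clauses. -/
def clausesPath : List (List ℕ) → List PathVert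
  | [] => [.sep]
  | vs :: l => .sep :: (clausePath vs ++ clausesPath l)

theorem clausesPath_eq (l : List (List ℕ)) :
    clausesPath l = (l.flatMap fun vs => .sep :: clausePath vs) ++ [.sep] := by
  induction l with
  | nil => rfl
  | cons vs l ih => simp [clausesPath, ih]

/-- All vertices of the path. -/
def fullPath (n k : ℕ) (rs : List (List Bool)) : List PathVert :=
  clausesPath (rs.map (clauseVars n k))

theorem reverse_rowVerts (n k : ℕ) (r : List Bool) :
    (rowVerts n k r).reverse = .sep :: clausePath (clauseVars n k r) := by
  rw [rowVerts, List.reverse_append, reverse_accum, clausePath, clauseVars, List.flatMap_assoc]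
  simp only [List.reverse_singleton, List.singleton_append, List.cons.injEq, true_and]
  congr 1
  funext j
  rw [reverse_accum, List.flatMap_assoc]
  congr 1
  funext u
  unfold litVerts
  split_ifs <;> simp [mul_add]

/-- The separator in front is the final vertex of the path, which `finish` writes separately. -/
theorem reverse_allVerts (n k : ℕ) (rs : List (List Bool)) :
    (PathVert.sep :: allVerts n k rs).reverse = fullPath n k rs := by
  rw [List.reverse_cons, allVerts, famVerts, reverse_accum, fullPath, clausesPath_eq,
    List.flatMap_map, ← flatMap_range_getD (fun r => PathVert.sep :: clausePath (clauseVars n k r))]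
  simp only [reverse_rowVerts]

theorem length_fullPath (n k : ℕ) (rs : List (List Bool)) :
    (fullPath n k rs).length = (allVerts n k rs).length + 1 := by
  rw [← reverse_allVerts, List.length_reverse, List.length_cons]

theorem mem_pathEdges {b : ℕ} {P : List PathVert} {e : ℕ × ℕ} :
    e ∈ pathEdges b P ↔ ∃ i, ∃ h : i < P.reverse.length,
      e ∈ attachEdges (b + i) P.reverse[i] ∨ e = (b + i, b + i + 1) := by
  induction P with
  | nil => simp [pathEdges]
  | cons p P ih =>
    simp only [pathEdges, List.mem_append, List.mem_cons, ih]
    constructor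
    · rintro (h | h | ⟨i, h, h'⟩)
      · exact ⟨P.length, by simp, .inl (by simpa using h)⟩
      · exact ⟨P.length, by simp, .inr h⟩
      · have hi : i < P.length := by simpa using h
        refine ⟨i, by simp; omega, ?_⟩
        simp only [List.reverse_cons]
        rwa [List.getElem_append_left h]
    · rintro ⟨i, h, h'⟩
      have hi : i < P.length + 1 := by simpa using h
      simp only [List.reverse_cons] at h'
      by_cases hP : i < P.reverse.length
      · rw [List.getElem_append_left hP] at h'
        exact .inr (.inr ⟨i, hP, h'⟩)
      · have hP' : i = P.length := by simp at hP; omega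
        subst hP'
        rw [List.getElem_append_right (by simp)] at h'
        rcases h' with h' | h'
        · exact .inl (by simpa using h')
        · exact .inr (.inl h')

theorem mem_varEdges {n k : ℕ} {e : ℕ × ℕ} :
    e ∈ varEdges n k ↔ (∃ j < k, ∃ u < n, e ∈ gadgetEdges (4 * (n * j + u))) ∨
      (∃ j < k, ∃ u, ∃ u' < n, u < u' ∧
        e = (7 + 4 * (n * j + u), 7 + 4 * (n * j + u'))) := by
  simp only [varEdges, mem_accum, List.mem_append, conflictEdges, List.mem_singleton]
  constructor
  · rintro ⟨j, hj, u, hu, ⟨d, hd, h⟩ | h⟩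
    · exact .inr ⟨j, hj, u, u + (d + 1), by omega, by omega, h.trans (by ring_nf)⟩
    · exact .inl ⟨j, hj, u, hu, h⟩
  · rintro (⟨j, hj, u, hu, h⟩ | ⟨j, hj, u, u', hu', huu, h⟩)
    · exact ⟨j, hj, u, hu, .inr h⟩
    · obtain ⟨d, rfl⟩ := Nat.exists_eq_add_of_lt huu
      exact ⟨j, hj, u, by omega, .inl ⟨d, by omega, h.trans (by ring_nf)⟩⟩

theorem mem_pathEdges_fullPath {n k b : ℕ} {rs : List (List Bool)} {e : ℕ × ℕ} :
    (e ∈ attachEdges (b + (allVerts n k rs).length) .sep ∨ e ∈ pathEdges b (allVerts n k rs)) ↔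
      (∃ i, ∃ h : i < (fullPath n k rs).length, e ∈ attachEdges (b + i) (fullPath n k rs)[i]) ∨
      ∃ i, i + 1 < (fullPath n k rs).length ∧ e = (b + i, b + i + 1) := by
  rw [← reverse_allVerts, mem_pathEdges]
  generalize allVerts n k rs = P
  have hlast : ∀ h, (PathVert.sep :: P).reverse[P.length]'h = .sep := by simp
  have hinit : ∀ i (h : i < P.reverse.length), (PathVert.sep :: P).reverse[i]'(by
      simp at h ⊢; omega) = P.reverse[i] := by
    intro i h
    simp only [List.reverse_cons]
    rw [List.getElem_append_left h]
  have hlen : (PathVert.sep :: P).reverse.length = P.length + 1 := by simp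
  have hlen' : P.reverse.length = P.length := by simp
  constructor
  · rintro (h | ⟨i, h, h' | h'⟩)
    · exact .inl ⟨P.length, by omega, by rwa [hlast]⟩
    · exact .inl ⟨i, by omega, by rwa [hinit i h]⟩
    · exact .inr ⟨i, by omega, h'⟩
  · rintro (⟨i, h, h'⟩ | ⟨i, h, h'⟩)
    · by_cases hi : i < P.reverse.length
      · exact .inr ⟨i, hi, .inl (by rwa [hinit i hi] at h')⟩
      · have : i = P.length := by omega
        subst this
        rw [hlast] at h'
        exact .inl h'
    · exact .inr ⟨i, by omega, .inr h'⟩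

theorem mem_graphEdges {n k : ℕ} {rs : List (List Bool)} {e : ℕ × ℕ} :
    e ∈ graphEdges n k rs ↔ (e = (0, 1) ∨ e = (2, 3)) ∨
      ((∃ j < k, ∃ u < n, e ∈ gadgetEdges (4 * (n * j + u))) ∨
      (∃ j < k, ∃ u, ∃ u' < n, u < u' ∧
        e = (7 + 4 * (n * j + u), 7 + 4 * (n * j + u')))) ∨
      (∃ i, ∃ h : i < (fullPath n k rs).length,
        e ∈ attachEdges (base n k + i) (fullPath n k rs)[i]) ∨
      ∃ i, i + 1 < (fullPath n k rs).length ∧ e = (base n k + i, base n k + i + 1) := by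
  rw [graphEdges, List.mem_append, List.mem_append, List.mem_append, ← or_assoc,
    mem_pathEdges_fullPath, mem_varEdges, List.mem_cons, List.mem_singleton, or_comm, or_assoc,
    or_left_comm]

/-- Whatever follows a clause begins with a separator, either that of the next clause or the final
one. -/
theorem clausesPath_split {l : List (List ℕ)} {vs : List ℕ} (h : vs ∈ l) :
    ∃ pre post, clausesPath l = pre ++ .sep :: (clausePath vs ++ .sep :: post) := by
  induction l with
  | nil => simp at h
  | cons ws l ih =>
    rcases List.mem_cons.1 h with rfl | h
    · cases l with
      | nil => exact ⟨[], [], rfl⟩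
      | cons ws l => exact ⟨[], clausePath ws ++ clausesPath l, rfl⟩
    · obtain ⟨pre, post, h⟩ := ih h
      exact ⟨.sep :: (clausePath ws ++ pre), post, by simp [clausesPath, h]⟩

theorem lit_mem_clausesPath {l : List (List ℕ)} {v : ℕ} (h : .lit v ∈ clausesPath l) :
    ∃ vs ∈ l, v ∈ vs := by
  induction l with
  | nil => simp [clausesPath] at h
  | cons vs l ih =>
    simp only [clausesPath, List.mem_cons, List.mem_append, reduceCtorEq, false_or] at h
    rcases h with h | h
    · refine ⟨vs, by simp, ?_⟩
      simpa [clausePath] using h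
    · obtain ⟨ws, h1, h2⟩ := ih h
      exact ⟨ws, by simp [h1], h2⟩

theorem lit_mem_fullPath {n k v : ℕ} {rs : List (List Bool)} (h : .lit v ∈ fullPath n k rs) :
    ∃ j < k, ∃ u < n, v = 4 * (n * j + u) := by
  obtain ⟨vs, h1, h2⟩ := lit_mem_clausesPath h
  obtain ⟨r, -, rfl⟩ := List.mem_map.1 h1
  obtain ⟨j, hj, u, hu, -, h⟩ := mem_clauseVars.1 h2
  exact ⟨j, hj, u, hu, h⟩

/-! ### Stable cutsets as labellings -/

/-- The labels of two adjacent vertices: `none` stands for the cutset, and the two other labels for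
the sides of the cutset. -/
def compat : Option Bool → Option Bool → Bool
  | none, none => false
  | none, some _ => true
  | some _, none => true
  | some a, some b => a == b

theorem compat_comm (a b : Option Bool) : compat a b = compat b a := by
  revert a b
  decide

theorem eq_of_compat : ∀ a b : Option Bool, compat a b = true → a ≠ none → b ≠ none → a = b := by
  decide

/-- Given a cutset, choose two separated vertices and label by reachability from the first.
Conversely, a walk that avoids the label `none` cannot change its label, so vertices with different
sides are separated. -/
theorem exists_stableCutset_iff {V : Type} (G : SimpleGraph V) :
    (∃ S, ParamComplexity.IsStableCutset G S) ↔ ∃ f : V → Option Bool,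
      (∀ u v, G.Adj u v → compat (f u) (f v) = true) ∧ (∃ x, f x = some true) ∧
        ∃ y, f y = some false := by
  classical
  constructor
  · rintro ⟨S, hS, hc⟩
    unfold SimpleGraph.Preconnected at hc
    push Not at hc
    obtain ⟨x, y, hxy⟩ := hc
    let f : V → Option Bool := fun v =>
      if h : v ∈ S then none else some (decide ((G.induce Sᶜ).Reachable x ⟨v, h⟩))
    refine ⟨f, fun u v huv => ?_, ⟨x, ?_⟩, ⟨y, ?_⟩⟩
    · by_cases hu : u ∈ S <;> by_cases hv : v ∈ S
      · exact absurd huv (hS hu hv huv.ne)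
      · simp [f, hu, hv, compat]
      · simp [f, hu, hv, compat]
      · have hadj : (G.induce Sᶜ).Adj ⟨u, hu⟩ ⟨v, hv⟩ := huv
        simp only [f, hu, hv, dite_false, compat, beq_iff_eq, decide_eq_decide]
        exact ⟨fun h => h.trans hadj.reachable, fun h => h.trans hadj.symm.reachable⟩
    · have hx : (x : V) ∉ S := x.2
      simp only [f, hx, dite_false, Option.some.injEq, decide_eq_true_eq]
      exact SimpleGraph.Reachable.refl _
    · have hy : (y : V) ∉ S := y.2
      simp only [f, hy, dite_false, Option.some.injEq, decide_eq_false_iff_not]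
      exact hxy
  · rintro ⟨f, hf, ⟨x, hx⟩, ⟨y, hy⟩⟩
    refine ⟨{v | f v = none}, fun u hu v hv _ huv => ?_, fun hc => ?_⟩
    · have h := hf u v huv
      have hu' : f u = none := hu
      have hv' : f v = none := hv
      rw [hu', hv'] at h
      cases h
    · obtain ⟨p⟩ := hc ⟨x, by simp [hx]⟩ ⟨y, by simp [hy]⟩
      have key : ∀ {a b : ({v | f v = none}ᶜ : Set V)}, (G.induce {v | f v = none}ᶜ).Walk a b →
          f a = f b := by
        intro a b p
        induction p with
        | nil => rfl
        | @cons a b c hab _ ih =>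
          rw [← ih]
          exact eq_of_compat _ _ (hf _ _ hab) a.2 b.2
      have := key p
      simp [hx, hy] at this

end StackProgram

namespace StackProgram

/-! ### From a labelling to a hitting set -/

/-- At least one vertex of an adjacent pair is outside the cutset; its side is `c`, and it restricts
every common neighbour. -/
theorem exists_side : ∀ a b : Option Bool, compat a b = true → ∃ c, (a = none ∨ a = some c) ∧
    (b = none ∨ b = some c) ∧
    ∀ w, compat w a = true → compat w b = true → w = none ∨ w = some c := by
  decide

/-- One of the two adjacent vertices is outside the cutset, and its side must be both `c` and `d`.
Applied when both terminal pairs have the same side, this forces the variables to that side. -/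
theorem eq_of_forcing_gadget : ∀ (c d : Bool) (t t' : Option Bool), (t = none ∨ t = some c) →
    (t = none ∨ t = some d) → (t' = none ∨ t' = some c) → (t' = none ∨ t' = some d) →
    compat t t' = true → c = d := by
  decide

theorem eq_none_of_ne : ∀ (c d : Bool) (t : Option Bool), (t = none ∨ t = some c) →
    (t = none ∨ t = some d) → c ≠ d → t = none := by
  decide

theorem eq_some_of_compat_none : ∀ (c : Bool) (t : Option Bool), compat none t = true →
    (t = none ∨ t = some c) → t = some c := by
  decide

theorem eq_none_of_compat_some : ∀ (c d : Bool) (t : Option Bool), compat (some c) t = true →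
    (t = none ∨ t = some d) → c ≠ d → t = none := by
  decide

theorem eq_of_ne_of_ne : ∀ s c d : Bool, c ≠ d → s ≠ c → s = d := by
  decide

/-- A clause without a true literal is a contradiction. -/
theorem false_of_clause {f : ℕ → Option Bool} {b : ℕ} {c d : Bool} (hcd : c ≠ d)
    {Q : List PathVert}
    (hf : ∀ i, i + 1 < Q.length → compat (f (b + i)) (f (b + i + 1)) = true)
    (hsep : ∀ i, Q[i]? = some .sep → f (b + i) = none)
    (hmid : ∀ i, Q[i]? = some .mid → f (b + i) = none ∨ f (b + i) = some c)
    {vs : List ℕ} {pre post : List PathVert}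
    (hQ : Q = pre ++ (clausePath vs ++ .sep :: post)) {p : ℕ} (hp : pre.length = p + 1)
    (hpre : f (b + p) = none)
    (hlit : ∀ v ∈ vs, ∀ i, Q[i]? = some (.lit v) → f (b + i) = none ∨ f (b + i) = some d) :
    False := by
  induction vs generalizing pre p with
  | nil =>
    have h1 : Q[p + 1]? = some .sep := by
      rw [hQ, List.getElem?_append_right (by omega), hp]
      simp [clausePath]
    -- All literals are used up, and the cutset vertex at `p` is followed by a separator, which is
    -- in the cutset as well.
    have h2 := hsep _ h1
    have h3 := hf p (List.getElem?_eq_some_iff.1 h1).1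
    rw [hpre, show b + p + 1 = b + (p + 1) by ring, h2] at h3
    cases h3
  | cons v vs ih =>
    have hQ' : Q = pre ++ (.mid :: .lit v :: (clausePath vs ++ .sep :: post)) := by
      rw [hQ]; simp [clausePath]
    have h1 : Q[p + 1]? = some .mid := by
      rw [hQ', List.getElem?_append_right (by omega), hp]
      simp
    have h2 : Q[p + 2]? = some (.lit v) := by
      rw [hQ', List.getElem?_append_right (by omega), hp]
      simp
    have h3 := hf p (List.getElem?_eq_some_iff.1 h1).1
    have h4 := hf (p + 1) (List.getElem?_eq_some_iff.1 h2).1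
    rw [hpre] at h3
    -- Next to a cutset vertex, the intermediate vertex must take side `c`; this pushes the false
    -- literal after it, of side `d`, into the cutset.
    have h5 := eq_some_of_compat_none c _ h3 (hmid (p + 1) h1)
    rw [show b + (p + 1) = b + p + 1 by ring, h5] at h4
    have h6 := eq_none_of_compat_some c d _ h4 (hlit v (by simp) (p + 2) h2) hcd
    exact ih (pre := pre ++ [.mid, .lit v]) (p := p + 2) (by simp [hQ']) (by simp [hp]) h6
      fun w hw => hlit w (by simp [hw])

theorem exists_hittingSet {n k : ℕ} {rs : List (List Bool)} {f : ℕ → Option Bool}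
    (hf : ∀ e ∈ graphEdges n k rs, compat (f e.1) (f e.2) = true) {x y : ℕ}
    (hx : x < base n k + (fullPath n k rs).length)
    (hy : y < base n k + (fullPath n k rs).length) (hfx : f x = some true)
    (hfy : f y = some false) :
    ∃ S : Finset (Fin n), S.card ≤ k ∧ ∀ r ∈ rs, ∃ u ∈ S, r[(u : ℕ)]? = some true := by
  classical
  simp only [mem_graphEdges] at hf
  obtain ⟨c, ha0, ha1, hc⟩ := exists_side _ _ (hf (0, 1) (.inl (.inl rfl)))
  obtain ⟨d, hb0, hb1, hd⟩ := exists_side _ _ (hf (2, 3) (.inl (.inr rfl)))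
  have hvar : ∀ j < k, ∀ u < n, ∀ e ∈ gadgetEdges (4 * (n * j + u)),
      compat (f e.1) (f e.2) = true :=
    fun j hj u hu e he => hf e (.inr (.inl (.inl ⟨j, hj, u, hu, he⟩)))
  have hy0 : ∀ j u, ∃ g, j < k → u < n → (f (4 + 4 * (n * j + u)) = none ∨
      f (4 + 4 * (n * j + u)) = some g) ∧ (f (5 + 4 * (n * j + u)) = none ∨
      f (5 + 4 * (n * j + u)) = some g) ∧ ∀ w, compat w (f (4 + 4 * (n * j + u))) = true →
      compat w (f (5 + 4 * (n * j + u))) = true → w = none ∨ w = some g := by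
    intro j u
    by_cases h : j < k ∧ u < n
    · obtain ⟨g, hg⟩ := exists_side _ _ (hvar j h.1 u h.2 (_, _) (.head _))
      exact ⟨g, fun _ _ => hg⟩
    -- A dummy side for indices that belong to no variable, so that `choose` gives a total function.
    · exact ⟨true, fun h1 h2 => absurd ⟨h1, h2⟩ h⟩
  choose g hg using hy0
  have ht : ∀ j < k, ∀ u < n, (f (6 + 4 * (n * j + u)) = none ∨
      f (6 + 4 * (n * j + u)) = some (g j u)) ∧ (f (6 + 4 * (n * j + u)) = none ∨
      f (6 + 4 * (n * j + u)) = some c) ∧ (f (7 + 4 * (n * j + u)) = none ∨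
      f (7 + 4 * (n * j + u)) = some (g j u)) ∧ (f (7 + 4 * (n * j + u)) = none ∨
      f (7 + 4 * (n * j + u)) = some d) ∧
      compat (f (6 + 4 * (n * j + u))) (f (7 + 4 * (n * j + u))) = true := by
    intro j hj u hu
    have h := hvar j hj u hu
    simp only [gadgetEdges, List.forall_mem_cons] at h
    obtain ⟨-, h1, h2, h3, h4, h5, h6, h7, h8, h9, -⟩ := h
    exact ⟨(hg j u hj hu).2.2 _ h1 h2, hc _ h6 h7, (hg j u hj hu).2.2 _ h3 h4, hd _ h8 h9, h5⟩
  have hatt : ∀ i p, (fullPath n k rs)[i]? = some p → ∀ e ∈ attachEdges (base n k + i) p,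
      compat (f e.1) (f e.2) = true := by
    intro i p hp e he
    obtain ⟨hi, rfl⟩ := List.getElem?_eq_some_iff.1 hp
    exact hf e (.inr (.inr (.inl ⟨i, hi, he⟩)))
  have hmid : ∀ i, (fullPath n k rs)[i]? = some .mid →
      f (base n k + i) = none ∨ f (base n k + i) = some c := by
    intro i hi
    have h := hatt i _ hi
    simp only [attachEdges, List.forall_mem_cons] at h
    exact hc _ h.1 h.2.1
  have hsep : ∀ i, (fullPath n k rs)[i]? = some .sep →
      (f (base n k + i) = none ∨ f (base n k + i) = some c) ∧
      (f (base n k + i) = none ∨ f (base n k + i) = some d) := by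
    intro i hi
    have h := hatt i _ hi
    simp only [attachEdges, List.forall_mem_cons] at h
    exact ⟨hc _ h.1 h.2.1, hd _ h.2.2.1 h.2.2.2.1⟩
  have hlit : ∀ j < k, ∀ u < n, ∀ i, (fullPath n k rs)[i]? = some (.lit (4 * (n * j + u))) →
      f (base n k + i) = none ∨ f (base n k + i) = some (g j u) := by
    intro j hj u hu i hi
    have h := hatt i _ hi
    simp only [attachEdges, List.forall_mem_cons] at h
    exact (hg j u hj hu).2.2 _ h.1 h.2.1
  -- If the terminal sides agreed, every vertex would be in the cutset or on that one side,
  -- contradicting `x` and `y`.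
  have hne : c ≠ d := by
    rintro rfl
    have hgc : ∀ j < k, ∀ u < n, g j u = c := by
      intro j hj u hu
      obtain ⟨h1, h2, h3, h4, h5⟩ := ht j hj u hu
      exact eq_of_forcing_gadget _ _ _ _ h1 h2 h3 h4 h5
    have key : ∀ z < base n k + (fullPath n k rs).length, f z = none ∨ f z = some c := by
      intro z hz
      by_cases hzb : z < base n k
      · by_cases hz4 : z < 4
        · interval_cases z <;> assumption
        -- `q` is the number `n * j + u` of the variable, and `r` the position among its four
        -- vertices.
        · obtain ⟨q, r, hr, rfl⟩ : ∃ q r, r < 4 ∧ z = 4 + r + 4 * q :=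
            ⟨(z - 4) / 4, (z - 4) % 4, by omega, by omega⟩
          unfold base at hzb
          have hq : q < n * k := by omega
          have hn : 0 < n := Nat.pos_of_mul_pos_right (Nat.zero_lt_of_lt hq)
          have hj : q / n < k := Nat.div_lt_of_lt_mul hq
          have hu : q % n < n := Nat.mod_lt _ hn
          have hqe : n * (q / n) + q % n = q := Nat.div_add_mod q n
          have h1 := hg _ _ hj hu
          have h2 := ht _ hj _ hu
          rw [hgc _ hj _ hu, hqe] at h1 h2
          interval_cases r
          · exact h1.1
          · exact h1.2.1
          · exact h2.1
          · exact h2.2.2.1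
      · obtain ⟨i, rfl⟩ := Nat.exists_eq_add_of_le (not_lt.1 hzb)
        have hi : i < (fullPath n k rs).length := by omega
        have hi' := List.getElem?_eq_getElem hi
        cases hp : (fullPath n k rs)[i] with
        | sep => exact (hsep i (hi'.trans (congrArg _ hp))).1
        | mid => exact hmid i (hi'.trans (congrArg _ hp))
        | lit v =>
          obtain ⟨j, hj, u, hu, rfl⟩ := lit_mem_fullPath (hp ▸ List.getElem_mem hi)
          have := hlit j hj u hu i (hi'.trans (congrArg _ hp))
          rwa [hgc j hj u hu] at this
    have h1 := key x hx
    have h2 := key y hy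
    rw [hfx] at h1
    rw [hfy] at h2
    revert h1 h2
    cases c <;> simp
  -- True variables have their last vertex in the cutset, because it sees both side `c` and side
  -- `d`; the conflict edge forbids two such vertices in one row.
  have huniq : ∀ j < k, ∀ u < n, ∀ u' < n, g j u = c → g j u' = c → u < u' → False := by
    intro j hj u hu u' hu' h h' huu
    have h1 := hf (_, _) (.inr (.inl (.inr ⟨j, hj, u, u', hu', huu, rfl⟩)))
    have h2 := ht j hj u hu
    have h3 := ht j hj u' hu'
    rw [h] at h2
    rw [h'] at h3
    rw [eq_none_of_ne _ _ _ h2.2.2.1 h2.2.2.2.1 hne, eq_none_of_ne _ _ _ h3.2.2.1 h3.2.2.2.1 hne]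
      at h1
    cases h1
  refine ⟨Finset.univ.filter fun u => ∃ j < k, g j u = c, ?_, fun r hr => ?_⟩
  -- Sending a selected element to a row that selects it is injective by `huniq`, so at most `k`
  -- elements are selected.
  · choose! ρ hρ using fun (u : Fin n) (hu : ∃ j < k, g j u = c) => hu
    refine (Finset.card_le_card_of_injOn (t := Finset.range k) ρ (fun u hu => ?_) ?_).trans
      (Finset.card_range k).le
    · simpa using (hρ u (by simpa using hu)).1
    · intro u hu u' hu' huu
      have h := hρ u (by simpa using hu)
      have h' := hρ u' (by simpa using hu')
      have huu : ρ u = ρ u' := huu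
      rw [← huu] at h'
      rcases lt_trichotomy u u' with hlt | heq | hlt
      · exact (huniq _ h.1 u u.2 u' u'.2 h.2 h'.2 hlt).elim
      · exact heq
      · exact (huniq _ h.1 u' u'.2 u u.2 h'.2 h.2 hlt).elim
  · by_contra hcon
    push Not at hcon
    obtain ⟨pre, post, hQ⟩ := clausesPath_split (List.mem_map_of_mem (f := clauseVars n k) hr)
    have hQ' : fullPath n k rs = (pre ++ [.sep]) ++
        (clausePath (clauseVars n k r) ++ .sep :: post) := by
      rw [fullPath, hQ]; simp
    have hsep' : ∀ i, (fullPath n k rs)[i]? = some .sep → f (base n k + i) = none :=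
      fun i hi => eq_none_of_ne _ _ _ (hsep i hi).1 (hsep i hi).2 hne
    refine false_of_clause hne
      (fun i hi => hf (_, _) (.inr (.inr (.inr ⟨i, hi, rfl⟩)))) hsep' hmid hQ' (p := pre.length)
      (by simp) (hsep' _ (by rw [hQ']; simp)) fun v hv i hi => ?_
    obtain ⟨j, hj, u, hu, hru, rfl⟩ := mem_clauseVars.1 hv
    -- If the set of `r` is not hit, all variables of its clause are false, so their literals are
    -- restricted to side `d`.
    have h1 : g j u ≠ c := fun h => hcon ⟨u, hu⟩ (by simpa using ⟨j, hj, h⟩) hru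
    exact eq_of_ne_of_ne _ _ _ hne h1 ▸ hlit j hj u hu i hi

end StackProgram

namespace StackProgram

/-! ### From a hitting set to a labelling -/

/-- Labels for a path, given the values of the variables. The Boolean argument says if the previous
vertex is outside the cutset. -/
def pathLab (T : ℕ → Bool) : Bool → List PathVert → List (Option Bool)
  | _, [] => []
  | _, .sep :: P => none :: pathLab T false P
  | s, .mid :: P => (if s then none else some true) :: pathLab T s P
  | s, .lit v :: P =>
    (if T v then some true else if s then some false else none) :: pathLab T (s || T v) P

/-- The labels which the edges between the path and the other vertices allow. -/
def Allowed (T : ℕ → Bool) : PathVert → Option Bool → Prop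
  | .sep, w => w = none
  | .mid, w => w = none ∨ w = some true
  | .lit v, w => w = none ∨ w = some (T v)

theorem forall₂_pathLab (T : ℕ → Bool) (s : Bool) (P : List PathVert) :
    List.Forall₂ (Allowed T) P (pathLab T s P) := by
  induction P generalizing s with
  | nil => exact .nil
  | cons p P ih =>
    cases p with
    | sep => exact .cons rfl (ih _)
    | mid => exact .cons (by cases s <;> simp [Allowed]) (ih _)
    | lit v => exact .cons (by cases h : T v <;> cases s <;> simp [Allowed, h]) (ih _)

/-- Here `a` labels the last separator or literal before the rest of the clause. Before the first
true literal the labels alternate between the cutset and `some true`; afterwards the intermediate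
vertices are in the cutset and the literals are not, so the next separator causes no conflict. Hence
it is enough that `a` is outside the cutset or a true literal is still to come. -/
theorem isChain_clause {T : ℕ → Bool} {rest : List PathVert}
    (h : List.IsChain (fun a b => compat a b = true) (none :: pathLab T false rest))
    (vs : List ℕ) (a : Option Bool) (ha : a.isSome = true ∨ ∃ v ∈ vs, T v = true) :
    List.IsChain (fun a b => compat a b = true)
      (a :: pathLab T a.isSome (clausePath vs ++ .sep :: rest)) := by
  induction vs generalizing a with
  | nil =>
    cases a with
    | none => simp at ha
    | some a => exact List.isChain_cons_cons.2 ⟨rfl, h⟩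
  | cons v vs ih =>
    have hc : clausePath (v :: vs) ++ .sep :: rest =
      .mid :: .lit v :: (clausePath vs ++ .sep :: rest) := by simp [clausePath]
    rw [hc]
    simp only [pathLab]
    refine List.isChain_cons_cons.2 ⟨by cases a <;> rfl, List.isChain_cons_cons.2 ⟨?_, ?_⟩⟩
    · cases T v <;> cases a <;> rfl
    · have h1 := ih (if T v then some true else if a.isSome then some false else none) ?_
      · have h2 : (if T v then some true else if a.isSome then some false else none).isSome =
            (a.isSome || T v) := by cases T v <;> cases a <;> rfl
        rwa [h2] at h1
      · rcases ha with ha | ⟨w, hw, hT⟩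
        · cases T v <;> simp [ha]
        · rcases List.mem_cons.1 hw with rfl | hw
          · simp [hT]
          · exact .inr ⟨w, hw, hT⟩

theorem isChain_clausesPath {T : ℕ → Bool} {l : List (List ℕ)}
    (hl : ∀ vs ∈ l, ∃ v ∈ vs, T v = true) :
    List.IsChain (fun a b => compat a b = true) (pathLab T false (clausesPath l)) := by
  induction l with
  | nil => exact List.isChain_singleton _
  | cons vs l ih =>
    have h1 := ih fun vs h => hl vs (by simp [h])
    obtain ⟨rest, hrest⟩ : ∃ rest, clausesPath l = .sep :: rest := by
      cases l <;> exact ⟨_, rfl⟩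
    rw [clausesPath, hrest]
    rw [hrest] at h1
    exact isChain_clause h1 vs none (.inr (hl vs (by simp)))

/-- The labels of the four vertices of a variable. -/
def varLab (t : Bool) : ℕ → Option Bool
  | 2 => if t then some true else none
  | 3 => if t then none else some false
  | _ => some t

/-- The labels of all vertices. -/
def labelling (b : ℕ) (T : ℕ → Bool) (P : List PathVert) (x : ℕ) : Option Bool :=
  if x < 2 then some true else if x < 4 then some false
  else if x < b then varLab (T (4 * ((x - 4) / 4))) ((x - 4) % 4)
  else (pathLab T false P)[x - b]?.getD none

section

variable {b : ℕ} {T : ℕ → Bool} {P : List PathVert}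

theorem labelling_var {i q x : ℕ} (hx : x = 4 + 4 * q + i) (hi : i < 4) (hq : 4 * q + 8 ≤ b) :
    labelling b T P x = varLab (T (4 * q)) i := by
  have h1 : (x - 4) / 4 = q := by omega
  have h2 : (x - 4) % 4 = i := by omega
  rw [labelling, if_neg (by omega), if_neg (by omega), if_pos (by omega), h1, h2]

theorem labelling_path (hb : 4 ≤ b) {i : ℕ} (hi : i < (pathLab T false P).length) :
    labelling b T P (b + i) = (pathLab T false P)[i] := by
  rw [labelling, if_neg (by omega), if_neg (by omega), if_neg (by omega), Nat.add_sub_cancel_left,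
    List.getElem?_eq_getElem hi]
  rfl

/-- Of the two vertices that see terminals, exactly one is in the cutset; the other has the side of
the variable, which is also that of its terminals. -/
theorem compat_gadgetEdges {q : ℕ} (hq : 4 * q + 8 ≤ b) {e : ℕ × ℕ}
    (he : e ∈ gadgetEdges (4 * q)) :
    compat (labelling b T P e.1) (labelling b T P e.2) = true := by
  have h (i x : ℕ) (hx : x = 4 + 4 * q + i) (hi : i < 4) := labelling_var (T := T) (P := P) hx hi hq
  have h0 := h 0 (4 + 4 * q) (by omega) (by omega)
  have h1 := h 1 (5 + 4 * q) (by omega) (by omega)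
  have h2 := h 2 (6 + 4 * q) (by omega) (by omega)
  have h3 := h 3 (7 + 4 * q) (by omega) (by omega)
  have t0 : labelling b T P 0 = some true := rfl
  have t1 : labelling b T P 1 = some true := rfl
  have t2 : labelling b T P 2 = some false := rfl
  have t3 : labelling b T P 3 = some false := rfl
  simp only [gadgetEdges, List.mem_cons, List.not_mem_nil, or_false] at he
  rcases he with rfl | rfl | rfl | rfl | rfl | rfl | rfl | rfl | rfl | rfl <;>
    simp only [h0, h1, h2, h3, t0, t1, t2, t3] <;> cases T (4 * q) <;> rfl

theorem compat_attachEdges {i : ℕ} {p : PathVert}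
    (h : Allowed T p (labelling b T P (b + i)))
    (hv : ∀ v, p = .lit v → ∃ q, v = 4 * q ∧ 4 * q + 8 ≤ b) {e : ℕ × ℕ}
    (he : e ∈ attachEdges (b + i) p) :
    compat (labelling b T P e.1) (labelling b T P e.2) = true := by
  have t0 : labelling b T P 0 = some true := rfl
  have t1 : labelling b T P 1 = some true := rfl
  have t2 : labelling b T P 2 = some false := rfl
  have t3 : labelling b T P 3 = some false := rfl
  cases p with
  | sep =>
    have h : labelling b T P (b + i) = none := h
    simp only [attachEdges, List.mem_cons, List.not_mem_nil, or_false] at he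
    rcases he with rfl | rfl | rfl | rfl <;> simp only [h, t0, t1, t2, t3] <;> rfl
  | mid =>
    simp only [attachEdges, List.mem_cons, List.not_mem_nil, or_false] at he
    rcases he with rfl | rfl <;> rcases h with h | h <;> simp only [h, t0, t1] <;> rfl
  | lit v =>
    obtain ⟨q, rfl, hq⟩ := hv v rfl
    have h0 := labelling_var (T := T) (P := P) (i := 0) (x := 4 + 4 * q) (by omega) (by omega) hq
    have h1 := labelling_var (T := T) (P := P) (i := 1) (x := 5 + 4 * q) (by omega) (by omega) hq
    simp only [attachEdges, List.mem_cons, List.not_mem_nil, or_false] at he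
    rcases he with rfl | rfl <;> rcases h with h | h <;> simp only [h, h0, h1] <;>
      cases T (4 * q) <;> rfl

end

theorem var_index_lt {n k j u : ℕ} (hj : j < k) (hu : u < n) :
    4 * (n * j + u) + 8 ≤ base n k := by
  have : n * (j + 1) ≤ n * k := Nat.mul_le_mul_left n hj
  rw [Nat.mul_add] at this
  unfold base
  omega

theorem var_index_inj {n j u j' u' : ℕ} (hu : u < n) (hu' : u' < n)
    (h : n * j + u = n * j' + u') : j = j' ∧ u = u' := by
  have h1 := congrArg (· % n) h
  simp only [Nat.mul_add_mod, Nat.mod_eq_of_lt hu, Nat.mod_eq_of_lt hu'] at h1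
  subst h1
  exact ⟨Nat.eq_of_mul_eq_mul_left (by omega) (Nat.add_right_cancel h), rfl⟩

theorem exists_labelling {n k : ℕ} {rs : List (List Bool)} (S : Finset (Fin n)) (hS : S.card ≤ k)
    (h : ∀ r ∈ rs, ∃ u ∈ S, r[(u : ℕ)]? = some true) :
    ∃ f : ℕ → Option Bool, (∀ e ∈ graphEdges n k rs, compat (f e.1) (f e.2) = true) ∧
      f 0 = some true ∧ f 2 = some false := by
  classical
  -- An enumeration of `S` puts its elements into different rows; there are enough rows because
  -- `S.card ≤ k`.
  let ρ : S → ℕ := fun u => (S.equivFin u : ℕ)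
  have hρ : Function.Injective ρ := fun u v huv => S.equivFin.injective (Fin.ext huv)
  have hρk : ∀ u, ρ u < k := fun u => (S.equivFin u).2.trans_le hS
  let T : ℕ → Bool := fun v => decide (∃ u : S, v = 4 * (n * ρ u + (u : Fin n)))
  have hb : 4 ≤ base n k := by unfold base; omega
  have hP := forall₂_pathLab T false (fullPath n k rs)
  have hlen := hP.length_eq
  have hchain : List.IsChain (fun a b => compat a b = true)
      (pathLab T false (fullPath n k rs)) := by
    refine isChain_clausesPath fun vs hvs => ?_
    obtain ⟨r, hr, rfl⟩ := List.mem_map.1 hvs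
    obtain ⟨u, hu, hur⟩ := h r hr
    refine ⟨_, mem_clauseVars.2 ⟨ρ ⟨u, hu⟩, hρk _, u, u.2, hur, rfl⟩, ?_⟩
    simp only [T, decide_eq_true_eq]
    exact ⟨⟨u, hu⟩, rfl⟩
  refine ⟨labelling (base n k) T (fullPath n k rs), fun e he => ?_, rfl, rfl⟩
  rcases mem_graphEdges.1 he with (rfl | rfl) | (⟨j, hj, u, hu, he⟩ | ⟨j, hj, u, u', hu', huu, rfl⟩) |
    ⟨i, hi, he⟩ | ⟨i, hi, rfl⟩
  · rfl
  · rfl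
  · exact compat_gadgetEdges (var_index_lt hj hu) he
  · have hu : u < n := huu.trans hu'
    simp only
    rw [labelling_var (i := 3) (by omega) (by omega) (var_index_lt hj hu),
      labelling_var (i := 3) (by omega) (by omega) (var_index_lt hj hu')]
    by_cases h1 : T (4 * (n * j + u)) = true
    -- Two true variables in one row would come from elements of `S` with the same value of `ρ`,
    -- hence from one element, although `u < u'`.
    · have h2 : ¬ T (4 * (n * j + u')) = true := by
        intro h2
        simp only [T, decide_eq_true_eq] at h1 h2
        obtain ⟨v, hv⟩ := h1
        obtain ⟨v', hv'⟩ := h2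
        have h3 := var_index_inj hu v.1.2 (Nat.eq_of_mul_eq_mul_left (by norm_num) hv)
        have h4 := var_index_inj hu' v'.1.2 (Nat.eq_of_mul_eq_mul_left (by norm_num) hv')
        have h5 : v = v' := hρ (h3.1.symm.trans h4.1)
        rw [h3.2, h4.2, h5] at huu
        exact lt_irrefl _ huu
      rw [h1, (Bool.not_eq_true _).mp h2]
      rfl
    · rw [(Bool.not_eq_true _).mp h1]
      cases T (4 * (n * j + u')) <;> rfl
  · refine compat_attachEdges ?_ (fun v hv => ?_) he
    · rw [labelling_path hb (hlen ▸ hi)]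
      exact (List.forall₂_iff_get.1 hP).2 i hi (hlen ▸ hi)
    · obtain ⟨j, hj, u, hu, rfl⟩ := lit_mem_fullPath (hv ▸ List.getElem_mem hi)
      exact ⟨_, rfl, var_index_lt hj hu⟩
  · simp only
    rw [add_assoc, labelling_path hb (hlen ▸ (Nat.lt_succ_self i).trans hi),
      labelling_path hb (hlen ▸ hi)]
    exact List.isChain_iff_getElem.1 hchain i (hlen ▸ hi)

end StackProgram

/-! ### From words to instances, and correctness of the map -/

namespace StackProgram

open ParamComplexity

/-! ### Instances as words -/

theorem encodeInstance_injective {α : Type} : Function.Injective (encodeInstance (α := α)) := by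
  rintro ⟨x, k⟩ ⟨y, m⟩ h
  simp only [encodeInstance] at h
  induction k generalizing m with
  | zero =>
    cases m with
    | zero =>
      simp only [List.replicate_zero, List.nil_append] at h
      rw [List.map_injective_iff.2 (Option.some_injective _) h]
    | succ m => cases x <;> simp [List.replicate_succ] at h
  | succ k ih =>
    cases m with
    | zero => cases y <;> simp [List.replicate_succ] at h
    | succ m =>
      simp only [List.replicate_succ, List.cons_append, List.cons.injEq, true_and] at h
      have := ih m h
      simp only [Prod.mk.injEq] at this ⊢
      exact ⟨this.1, congrArg _ this.2⟩

theorem encodeWords_cons (w : List Bool) (ws : List (List Bool)) :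
    encodeWords (w :: ws) = w.map some ++ none :: encodeWords ws := by
  simp [encodeWords]

theorem map_some_append_none_inj {w w' : List Bool} {l l' : List (Option Bool)}
    (h : w.map some ++ none :: l = w'.map some ++ none :: l') : w = w' ∧ l = l' := by
  induction w generalizing w' with
  | nil => cases w' <;> simp_all
  | cons a w ih =>
    cases w' with
    | nil => simp at h
    | cons a' w' =>
      simp only [List.map_cons, List.cons_append, List.cons.injEq, Option.some.injEq] at h
      obtain ⟨rfl, h⟩ := h
      obtain ⟨rfl, rfl⟩ := ih h
      exact ⟨rfl, rfl⟩

/-- Membership in either problem asks for some object that is described by the word; injectivity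
recovers the data of that object. -/
theorem encodeWords_injective : Function.Injective encodeWords := by
  intro l l' h
  induction l generalizing l' with
  | nil =>
    cases l' with
    | nil => rfl
    | cons w l' =>
      rw [encodeWords_cons] at h
      cases w <;> simp [encodeWords] at h
  | cons w l ih =>
    cases l' with
    | nil =>
      rw [encodeWords_cons] at h
      cases w <;> simp [encodeWords] at h
    | cons w' l' =>
      rw [encodeWords_cons, encodeWords_cons] at h
      obtain ⟨rfl, h'⟩ := map_some_append_none_inj h
      rw [ih h']

theorem unary_injective : Function.Injective unary := fun a b h => by
  simpa [unary] using congrArg List.length h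

theorem map_some_encodeWords (ws : List (List Bool)) :
    (encodeWords ws).map some = ws.flatMap fun w => w.map bit ++ [sH] := by
  induction ws with
  | nil => rfl
  | cons w ws ih =>
    rw [encodeWords_cons, List.map_append, List.map_cons, ih]
    simp [Function.comp_def, sH]

theorem inputSyms_eq (n k : ℕ) (rows : List (List Bool)) :
    inputSyms n k rows = encodeInstance (encodeWords (unary n :: unary k :: rows), n) := by
  simp [encodeInstance, map_some_encodeWords, inputSyms, unary, num, sP, sT]

/-- The edges of a graph as unary words. -/
def edgeWords (E : List (ℕ × ℕ)) : List (List Bool) := E.flatMap fun e => [unary e.1, unary e.2]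

theorem edgeWords_injective : Function.Injective edgeWords := by
  intro E E' h
  induction E generalizing E' with
  | nil =>
    cases E' with
    | nil => rfl
    | cons e E' => simp [edgeWords] at h
  | cons e E ih =>
    cases E' with
    | nil => simp [edgeWords] at h
    | cons e' E' =>
      simp only [edgeWords, List.flatMap_cons, List.cons_append, List.nil_append,
        List.cons.injEq] at h
      rw [Prod.ext (unary_injective h.1) (unary_injective h.2.1), ih h.2.2]

/-- The word which describes the graph. -/
def graphWord (n k : ℕ) (rs : List (List Bool)) : List (Option Bool) :=
  encodeWords ((List.replicate (base n k) true ++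
    List.replicate ((fullPath n k rs).length) false) :: edgeWords (graphEdges n k rs))

theorem graphSyms_eq (n k : ℕ) (rs : List (List Bool)) :
    graphSyms n k rs = encodeInstance (graphWord n k rs, base n k) := by
  simp only [encodeInstance, graphWord, map_some_encodeWords, graphSyms, List.flatMap_cons,
    length_fullPath, List.map_append, List.map_replicate, List.append_assoc, num, sP, sT]
  simp only [List.singleton_append]
  congr 4
  simp [edgeWords, encodeEdges, encodeNum, List.flatMap_assoc, unary, sT]

/-! ### Correctness of the reduction -/

/-- Repeated rows do no harm: only the set of listed characteristic vectors enters the family, and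
every word of length `n` is such a vector. -/
theorem mem_hittingSet_iff {n k : ℕ} {rows : List (List Bool)} (hr : ∀ r ∈ rows, r.length = n) :
    (encodeWords (unary n :: unary k :: rows), n) ∈ hittingSet ↔
      ∃ S : Finset (Fin n), S.card ≤ k ∧ ∀ r ∈ rows, ∃ u ∈ S, r[(u : ℕ)]? = some true := by
  constructor
  · rintro ⟨I, ⟨L, hL, hx⟩, hn, S, hS, hF⟩
    have h := encodeWords_injective hx
    simp only [List.cons.injEq] at h hn
    obtain ⟨-, hk, rfl⟩ := h
    obtain rfl := unary_injective hk
    subst hn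
    refine ⟨S, hS, fun r hr => ?_⟩
    obtain ⟨F, hFL, rfl⟩ := List.mem_map.1 hr
    obtain ⟨u, hu⟩ := hF F (hL ▸ List.mem_toFinset.2 hFL)
    rw [Finset.mem_inter] at hu
    exact ⟨u, hu.1, by simp [charVector, hu.2]⟩
  · rintro ⟨S, hS, hF⟩
    let F : List Bool → Finset (Fin n) := fun r => Finset.univ.filter fun u =>
      r[(u : ℕ)]? = some true
    refine ⟨⟨n, (rows.map F).toFinset, k⟩, ⟨rows.map F, rfl, ?_⟩, rfl, S, hS, fun A hA => ?_⟩
    · have hrows : rows = (rows.map F).map charVector := by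
        rw [List.map_map]
        refine (List.map_id rows).symm.trans (List.map_congr_left fun r h => ?_)
        refine List.ext_getElem (by simp [charVector, hr r h]) fun i h1 h2 => ?_
        have h1 : i < r.length := h1
        simp [charVector, F, h1]
      exact congrArg (fun l => encodeWords (unary n :: unary k :: l)) hrows
    · obtain ⟨r, h, rfl⟩ := List.mem_map.1 (List.mem_toFinset.1 hA)
      obtain ⟨u, hu, hru⟩ := hF r h
      exact ⟨u, Finset.mem_inter.2 ⟨hu, by simpa [F] using hru⟩⟩

theorem graphEdges_lt {n k : ℕ} {rs : List (List Bool)} {e : ℕ × ℕ}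
    (he : e ∈ graphEdges n k rs) :
    e.1 < base n k + (fullPath n k rs).length ∧ e.2 < base n k + (fullPath n k rs).length ∧
      e.1 ≠ e.2 := by
  have hb : 4 ≤ base n k := by unfold base; omega
  rcases mem_graphEdges.1 he with (rfl | rfl) | (⟨j, hj, u, hu, he⟩ | ⟨j, hj, u, u', hu', huu, rfl⟩) |
    ⟨i, hi, he⟩ | ⟨i, hi, rfl⟩
  · simp only; omega
  · simp only; omega
  · have := var_index_lt hj hu
    simp only [gadgetEdges, List.mem_cons, List.not_mem_nil, or_false] at he
    rcases he with rfl | rfl | rfl | rfl | rfl | rfl | rfl | rfl | rfl | rfl <;> simp only <;> omega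
  · have := var_index_lt hj hu'
    simp only
    omega
  · cases hp : (fullPath n k rs)[i] with
    | sep =>
      simp only [hp, attachEdges, List.mem_cons, List.not_mem_nil, or_false] at he
      rcases he with rfl | rfl | rfl | rfl <;> simp only <;> omega
    | mid =>
      simp only [hp, attachEdges, List.mem_cons, List.not_mem_nil, or_false] at he
      rcases he with rfl | rfl <;> simp only <;> omega
    | lit v =>
      obtain ⟨j, hj, u, hu, rfl⟩ := lit_mem_fullPath (hp ▸ List.getElem_mem hi)
      have := var_index_lt hj hu
      simp only [hp, attachEdges, List.mem_cons, List.not_mem_nil, or_false] at he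
      rcases he with rfl | rfl <;> simp only <;> omega
  · simp only; omega

/-- All other edges have an endpoint below `base n k`, so the graph induced on the path vertices has
no chords. -/
theorem graphEdges_path {n k i j : ℕ} {rs : List (List Bool)} :
    (base n k + i, base n k + j) ∈ graphEdges n k rs ↔
      j = i + 1 ∧ j < (fullPath n k rs).length := by
  have hb : 4 ≤ base n k := by unfold base; omega
  constructor
  · intro he
    rcases mem_graphEdges.1 he with (he | he) | (⟨j, hj, u, hu, he⟩ | ⟨j, hj, u, u', hu', huu, he⟩) |
      ⟨i, hi, he⟩ | ⟨i, hi, he⟩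
    · simp only [Prod.mk.injEq] at he; omega
    · simp only [Prod.mk.injEq] at he; omega
    · have := var_index_lt hj hu
      simp only [gadgetEdges, List.mem_cons, List.not_mem_nil, or_false, Prod.mk.injEq] at he
      omega
    · have := var_index_lt hj hu'
      simp only [Prod.mk.injEq] at he
      omega
    · cases hp : (fullPath n k rs)[i] with
      | sep =>
        simp only [hp, attachEdges, List.mem_cons, List.not_mem_nil, or_false, Prod.mk.injEq] at he
        omega
      | mid =>
        simp only [hp, attachEdges, List.mem_cons, List.not_mem_nil, or_false, Prod.mk.injEq] at he
        omega
      | lit v =>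
        obtain ⟨j, hj, u, hu, rfl⟩ := lit_mem_fullPath (hp ▸ List.getElem_mem hi)
        have := var_index_lt hj hu
        simp only [hp, attachEdges, List.mem_cons, List.not_mem_nil, or_false, Prod.mk.injEq] at he
        omega
    · simp only [Prod.mk.injEq] at he
      omega
  · rintro ⟨rfl, h⟩
    exact mem_graphEdges.2 (.inr (.inr (.inr ⟨i, h, rfl⟩)))

/-- The graph with the list of edges `E`. -/
def edgeGraph (N : ℕ) (E : List (ℕ × ℕ)) (hE : ∀ e ∈ E, e.1 ≠ e.2) : SimpleGraph (Fin N) where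
  Adj u v := ((u : ℕ), (v : ℕ)) ∈ E ∨ ((v : ℕ), (u : ℕ)) ∈ E
  symm := ⟨fun _ _ h => h.symm⟩
  loopless := ⟨fun _ h => hE _ (h.elim id id) rfl⟩

/-- The vertices outside the path. -/
def baseSet (b m : ℕ) : Finset (Fin (b + m)) := Finset.univ.filter fun x => (x : ℕ) < b

theorem charVector_baseSet (b m : ℕ) :
    charVector (baseSet b m) = List.replicate b true ++ List.replicate m false := by
  refine List.ext_getElem (by simp [charVector]) fun i h1 h2 => ?_
  by_cases hi : i < b
  · rw [List.getElem_append_left (by simpa using hi)]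
    simp [charVector, baseSet, hi]
  · rw [List.getElem_append_right (by simpa using hi)]
    simp [charVector, baseSet, hi]

theorem card_baseSet (b m : ℕ) : (baseSet b m).card = b := by
  have h : baseSet b m = Finset.univ.map (Fin.castAddEmb m) := by
    ext x
    simp only [baseSet, Finset.mem_filter, Finset.mem_univ, true_and, Finset.mem_map]
    constructor
    · intro hx
      exact ⟨⟨x, hx⟩, rfl⟩
    · rintro ⟨y, rfl⟩
      exact y.2
  rw [h, Finset.card_map, Finset.card_univ, Fintype.card_fin]

theorem isSinglePath_induce {b m : ℕ} (G : SimpleGraph (Fin (b + (m + 1))))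
    (hG : ∀ i j : Fin (m + 1), G.Adj (Fin.natAdd b i) (Fin.natAdd b j) ↔
      (j : ℕ) = i + 1 ∨ (i : ℕ) = j + 1) :
    IsSinglePath (G.induce ((baseSet b (m + 1) : Set (Fin (b + (m + 1))))ᶜ)) := by
  refine ⟨m, ⟨SimpleGraph.Iso.symm ?_⟩⟩
  let φ : Fin (m + 1) → ((baseSet b (m + 1) : Set (Fin (b + (m + 1))))ᶜ : Set _) :=
    fun i => ⟨Fin.natAdd b i, by simp [baseSet]⟩
  have hφ : Function.Bijective φ := by
    constructor
    · intro i j h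
      simpa [φ] using h
    · rintro ⟨x, hx⟩
      have hx' : b ≤ x := by simpa [baseSet] using hx
      exact ⟨⟨x - b, by omega⟩, Subtype.ext (Fin.ext (by simp [φ]; omega))⟩
  refine ⟨Equiv.ofBijective φ hφ, ?_⟩
  intro i j
  rw [SimpleGraph.pathGraph_adj]
  refine (hG i j).trans ?_
  rw [eq_comm, @eq_comm _ (i : ℕ)]

/-- In the forward direction the word determines the edges and the number of vertices, and only the
cutset is needed. In the backward direction the graph is built from `graphEdges`, and the modulator
is an initial segment of its vertices. -/
theorem mem_stableCutsetModPath_iff {n k : ℕ} {rs : List (List Bool)} :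
    (graphWord n k rs, base n k) ∈ stableCutsetModPath ↔
      ∃ S : Finset (Fin n), S.card ≤ k ∧ ∀ r ∈ rs, ∃ u ∈ S, r[(u : ℕ)]? = some true := by
  constructor
  · rintro ⟨I, ⟨E, hE, hx⟩, -, -, hS⟩
    obtain ⟨f, hf, ⟨x, hx1⟩, ⟨y, hy1⟩⟩ := (exists_stableCutset_iff I.G).1 hS
    have h := encodeWords_injective hx
    rw [List.cons.injEq] at h
    have hN : base n k + (fullPath n k rs).length = I.N := by
      simpa [charVector] using congrArg List.length h.1
    have hE' : graphEdges n k rs = E.map fun e => ((e.1 : ℕ), (e.2 : ℕ)) := by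
      refine edgeWords_injective (h.2.trans ?_)
      simp [edgeWords, List.flatMap_map]
    refine exists_hittingSet (f := fun x => if h : x < I.N then f ⟨x, h⟩ else none) ?_
      (x := x) (y := y) (x.2.trans_eq hN.symm) (y.2.trans_eq hN.symm) (by simpa using hx1) (by simpa using hy1)
    intro e he
    rw [hE'] at he
    obtain ⟨e', he', rfl⟩ := List.mem_map.1 he
    simpa using hf _ _ ((hE _ _).2 (.inl he'))
  · rintro ⟨S, hS, h⟩
    obtain ⟨f, hf, h0, h2⟩ := exists_labelling S hS h
    have hb : 4 ≤ base n k := by unfold base; omega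
    obtain ⟨m, hm⟩ : ∃ m, (fullPath n k rs).length = m + 1 := ⟨_, length_fullPath n k rs⟩
    have hlt := fun e (he : e ∈ graphEdges n k rs) => graphEdges_lt he
    have hpath := fun i j => graphEdges_path (n := n) (k := k) (i := i) (j := j) (rs := rs)
    rw [graphWord]
    rw [hm] at hlt hpath ⊢
    refine ⟨⟨base n k + (m + 1), edgeGraph _ (graphEdges n k rs) fun e he => (hlt e he).2.2,
      baseSet (base n k) (m + 1)⟩, ⟨(graphEdges n k rs).pmap
        (fun e he => (⟨e.1, he.1⟩, ⟨e.2, he.2.1⟩)) hlt, ?_, ?_⟩, ?_, (card_baseSet _ _).symm, ?_⟩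
    · have key : ∀ u v : Fin (base n k + (m + 1)), ((u : ℕ), (v : ℕ)) ∈ graphEdges n k rs ↔
          (u, v) ∈ (graphEdges n k rs).pmap
            (fun e he => ((⟨e.1, he.1⟩ : Fin _), (⟨e.2, he.2.1⟩ : Fin _))) hlt := by
        intro u v
        rw [List.mem_pmap]
        constructor
        · intro h
          exact ⟨_, h, rfl⟩
        · rintro ⟨e, he, h⟩
          rw [Prod.mk.injEq] at h
          rw [← h.1, ← h.2]
          exact he
      exact fun u v => or_congr (key u v) (key v u)
    · rw [charVector_baseSet]
      rw [edgeWords, List.flatMap_def, List.flatMap_def, List.map_pmap, ← List.pmap_eq_map hlt]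
    · refine isSinglePath_induce _ fun i j => ?_
      have hij := hpath i j
      have hji := hpath j i
      have hi := i.2
      have hj := j.2
      refine (or_congr hij hji).trans ?_
      omega
    · refine (exists_stableCutset_iff _).2 ⟨fun x => f x, ?_, ⟨⟨0, ?_⟩, h0⟩, ⟨⟨2, ?_⟩, h2⟩⟩
      rotate_left
      · change 0 < base n k + (m + 1); omega
      · change 2 < base n k + (m + 1); omega
      rintro u v (h | h)
      · exact hf _ h
      · rw [compat_comm]
        exact hf _ h

/-- Every description begins with a terminated characteristic vector, so the empty word can serve as
the image of malformed inputs. -/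
theorem nil_notMem_stableCutsetModPath (k : ℕ) : ([], k) ∉ stableCutsetModPath := by
  rintro ⟨I, ⟨E, -, hx⟩, -⟩
  have h : encodeWords [] = _ := hx
  cases encodeWords_injective h

theorem single_raw (l : List Sym) : ({ raw := l } : Stacks).get = single .raw l := by
  funext w
  cases w <;> rfl

theorem single_out (l : List Sym) : ({ out := l } : Stacks).get = single .out l := by
  funext w
  cases w <;> rfl

theorem exists_image (p : List (Option Bool) × ℕ) : ∃ q : List (Option Bool) × ℕ,
    (∃ t ≤ 10 ^ 7 * ((encodeInstance p).length + 1) ^ 12, Run reduction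
      (single .raw (encodeInstance p).reverse) (single .out (encodeInstance q)) t) ∧
    (p ∈ hittingSet ↔ q ∈ stableCutsetModPath) ∧ q.2 ≤ 4 * p.2 ^ 2 + 4 := by
  rcases reduction_spec (encodeInstance p) with ⟨n, k, rows, hr, hl, h⟩ | ⟨hl, h⟩
  · refine ⟨(graphWord n (min n k) rows.reverse, base n (min n k)), ?_, ?_, ?_⟩
    · rw [graphSyms_eq] at h
      rw [← single_raw, ← single_out]
      exact h
    · rw [inputSyms_eq] at hl
      rw [encodeInstance_injective hl, mem_hittingSet_iff hr, mem_stableCutsetModPath_iff]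
      simp only [List.mem_reverse]
      -- Capping the bound at `n` changes nothing, since no subset of the ground set has more than
      -- `n` elements.
      refine exists_congr fun S => and_congr_left fun _ => ?_
      have := S.card_le_univ
      rw [Fintype.card_fin] at this
      omega
    · rw [inputSyms_eq] at hl
      rw [encodeInstance_injective hl]
      have := Nat.mul_le_mul_left n (min_le_left n k)
      simp only [base]
      nlinarith
  · refine ⟨([], 0), ?_, ?_, by simp⟩
    · rw [← single_raw, ← single_out]
      exact h
    · refine iff_of_false ?_ (nil_notMem_stableCutsetModPath 0)
      rintro ⟨I, ⟨L, -, hx⟩, hn, -⟩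
      refine hl ⟨I.n, I.k, L.map charVector, ?_, ?_⟩
      · intro r hr
        obtain ⟨F, -, rfl⟩ := List.mem_map.1 hr
        simp [charVector]
      · rw [inputSyms_eq, ← hx, ← hn]

end StackProgram

/-! ### Composition with an arbitrary PPT to Hitting Set -/

open StackProgram in
theorem mainTheorem2 :
    ParamComplexity.IsMK2Hard ParamComplexity.stableCutsetModPath := by
  intro α _ Q ⟨π, hπ⟩
  -- The reduction becomes a function by choice; the chosen image comes with a run of `reduction`
  -- that outputs it, and this is what makes the function computable.
  choose g hg using exists_image
  obtain ⟨b, hb⟩ := hπ.param_le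
  refine ⟨g ∘ π, ?_, fun p => (hπ.mem_iff p).trans (hg _).2.1, 4 * b ^ 2 + 4, fun p => ?_⟩
  · refine polyTime_comp reduction .raw .out (10 ^ 7 * (Polynomial.X + 1) ^ 12) (fun p => ?_)
      hπ.polyTime
    simpa using (hg p).1
  · refine (hg _).2.2.trans ?_
    have := Nat.pow_le_pow_left (hb p) 2
    simpa using this
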